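/- **Conventions.** Let $n,m\ge 1$. $B=B(x,r)\subset\mathbb R^n$ is a ball and $\lambda B=B(x,\lambda r)$; functions are real- or complex-valued. A weight is a nonnegative locally integrable function that is positive a.e.; $w(E)=\int_E w$. $A_\infty=\bigcup_{1\le q<\infty}A_q$ is the union of the Muckenhoupt classes. For a positive measurable function $\varphi$ on $\mathbb R^n\times(0,\infty)$, $M^{p,\varphi}(w)$ is the space of measurable $f$ with $$\|f\|_{M^{p,\varphi}(w)}=\sup_{x\in\mathbb R^n,\,r>0}\varphi(x,r)^{-1}\,w(B(x,r))^{-1/p}\Big(\int_{B(x,r)}|f|^p w\Big)^{1/p}<\infty .$$ $\|b\|_{BMO}=\sup_B\frac1{|B|}\int_B|b-b_B|$, where $b_B$ is the mean of $b$ over $B$, and $BMO$ is the space of locally integrable $b$ with $\|b\|_{BMO}<\infty$. An operator $T$ from a product $\prod_{i=1}^m D_i$ of function spaces to the measurable functions is *$m$-sublinear* if in each slot, for a.e. $x$, $|T(\dots,f_i+g_i,\dots)(x)|\le|T(\dots,f_i,\dots)(x)|+|T(\dots,g_i,\dots)(x)|$ and $|T(\dots,cf_i,\dots)(x)|=|c|\,|T(\dots,f_i,\dots)(x)|$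 for all scalars $c$; the exceptional null set may depend on the functions, but can be chosen common to all functions from any given finite-dimensional subspaces $V_i\subseteq D_i$. For $\vec b=(b_1,\dots,b_m)$ the *iterated commutator* is $$T_{\prod\vec b}(f_1,\dots,f_m)(x)=T\big((b_1(x)-b_1)f_1,\dots,(b_m(x)-b_m)f_m\big)(x).$$ For a ball $B$ put $f_i^0=f_i\chi_{2B}$ and $f_i^\infty=f_i\chi_{(2B)^c}$. * $T\in LS(\prod D_i)$ (local size condition): $T$ is $m$-sublinear on $\prod D_i$ and there is a constant $A$ such that for every ball $B$, all $f_i\in D_i$ and all $(\alpha_1,\dots,\alpha_m)\in\{0,\infty\}^m$ other than $(0,\dots,0)$, $$\|T(f_1^{\alpha_1},\dots,f_m^{\alpha_m})\|_{L^\infty(B)}\le A\sum_{j=1}^\infty\prod_{i=1}^m\frac1{|2^{j+1}B|}\int_{2^{j+1}B}|f_i(y_i)|\,dy_i .$$ * $T\in LB(\prod X_i\to Y)$ (local boundedness condition): $T$ is $m$-sublinear on $\prod X_i$ and there is a constant $A$ such that $\|T(f_1^0,\dots,f_m^0)\|_Y\le A\prod_i\|f_i\|_{X_i}$ for every ball $B$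 and all $f_i\in X_i$. **Theorem.** Let $1<p_k<\infty$ for $k=1,\dots,m$ and $1/p=\sum_k 1/p_k$. Let $\omega_1,\dots,\omega_m\in A_\infty$ with $\vec\omega=(\omega_1,\dots,\omega_m)\in A_{\vec P}$, i.e. $$\sup_B\Big(\frac1{|B|}\int_B\prod_{i=1}^m\omega_i^{p/p_i}\Big)^{1/p}\prod_{i=1}^m\Big(\frac1{|B|}\int_B\omega_i^{1-p_i'}\Big)^{1/p_i'}<\infty,\qquad p_i'=\frac{p_i}{p_i-1},$$ and let $v\in A_\infty$. Let $\varphi_{11},\dots,\varphi_{1m},\varphi_2$ be positive measurable functions on $\mathbb R^n\times(0,\infty)$ with $$\sup_{x\in\mathbb R^n,\,r>0}\varphi_2(x,r)^{-1}\int_r^\infty\Big(1+\log\frac tr\Big)^m\,\frac{\operatorname*{ess\,inf}_{t<\eta<\infty}\prod_{i=1}^m\varphi_{1i}(x,\eta)\,\omega_i(B(x,\eta))^{1/p_i}}{\prod_{i=1}^m\omega_i(B(x,t))^{1/p_i}}\,\frac{dt}t<\infty .$$ Write $M_i=M^{p_i,\varphi_{1i}}(\omega_i)$ and $Y=M^{p,\varphi_2}(v)$.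 1. Let $\vec b\in(BMO)^m$, let $T\in LS\big(\prod_i(M_i+b_iM_i)\big)$, where $M_i+b_iM_i=\{g+b_ih:g,h\in M_i\}$ (these spaces contain the functions to which $T$ is applied in $T_{\prod\vec b}$), and let $T_{\prod\vec b}\in LB\big(\prod_i M_i\to Y\big)$. Then $T_{\prod\vec b}$ is bounded from $M_1\times\cdots\times M_m$ to $Y$: it maps $\prod_iM_i$ into $Y$, and there is $C$ with $\|T_{\prod\vec b}(\vec f)\|_Y\le C\prod_i\|f_i\|_{M_i}$ for all $f_i\in M_i$. 2. For all $A_1,A_2\ge0$ there is a constant $C$, depending only on $A_1,A_2$ and on $n,m,p_i,\vec\omega,v,\varphi_{1i},\varphi_2$ and the scalar field (and so not on $T$ or $\vec b$ otherwise), such that: if in addition to the hypotheses of 1 the condition $T\in LS\big(\prod_i(M_i+b_iM_i)\big)$ holds with constant $A_1$, and for every ball $B$ and all $f_i\in M_i$ $$\|T_{\prod\vec b}(f_1^0,\dots,f_m^0)\|_Y\le A_2\prod_{j=1}^m\|b_j\|_{BMO}\prod_{i=1}^m\|f_i\|_{M_i},$$ then $\|T_{\prod\vec b}(\vec f)\|_Y\le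 C\prod_{j}\|b_j\|_{BMO}\prod_i\|f_i\|_{M_i}$ for all $f_i\in M_i$, i.e. $\|T_{\prod\vec b}\|_{M_1\times\cdots\times M_m\to Y}\le C\prod_j\|b_j\|_{BMO}$. -/

import Mathlib

open MeasureTheory Metric Set
open scoped NNReal ENNReal

noncomputable section

namespace MorreyComm

/-- The Euclidean space `ℝⁿ`. -/
abbrev Rn (n : ℕ) := EuclideanSpace ℝ (Fin n)

/-! ### Weights -/

/-- A weight: a nonnegative locally integrable function, positive almost everywhere. -/
structure IsWeight {n : ℕ} (w : Rn n → ℝ) : Prop where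
  nonneg : ∀ x, 0 ≤ w x
  locInt : LocallyIntegrable w volume
  pos : ∀ᵐ x, 0 < w x

/-- The weighted measure `w(S) = ∫_S w(x) dx`. -/
def wt {n : ℕ} (w : Rn n → ℝ) (S : Set (Rn n)) : ℝ≥0∞ :=
  ∫⁻ x in S, ENNReal.ofReal (w x)

/-- The Muckenhoupt class `A_1`. -/
def MemA1 {n : ℕ} (w : Rn n → ℝ) : Prop :=
  IsWeight w ∧ ∃ C : ℝ≥0, ∀ (x : Rn n) (r : ℝ), 0 < r →
    (⨍⁻ y in ball x r, ENNReal.ofReal (w y) ∂volume) ≤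
      C * essInf (fun y => ENNReal.ofReal (w y)) (volume.restrict (ball x r))

/-- The Muckenhoupt class `A_q`, for `1 < q < ∞`. -/
def MemAq {n : ℕ} (q : ℝ) (w : Rn n → ℝ) : Prop :=
  IsWeight w ∧ ∃ C : ℝ≥0, ∀ (x : Rn n) (r : ℝ), 0 < r →
    (⨍⁻ y in ball x r, ENNReal.ofReal (w y) ∂volume) *
      (⨍⁻ y in ball x r, ENNReal.ofReal (w y) ^ (-(1 / (q - 1))) ∂volume) ^ (q - 1) ≤ C

/-- The class `A_∞`, the union of the `A_q` for `1 ≤ q < ∞`. -/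
def MemAinfty {n : ℕ} (w : Rn n → ℝ) : Prop :=
  MemA1 w ∨ ∃ q : ℝ, 1 < q ∧ MemAq q w

/-- The multiple weight class `A_P` for exponents `1 < p_i < ∞`, with `1/p = ∑ 1/p_i`,
`v_ω = ∏ ω_i^{p/p_i}` and `p_i' = p_i/(p_i - 1)`. -/
def MemAP {n m : ℕ} (pv : Fin m → ℝ) (p : ℝ) (ω : Fin m → Rn n → ℝ) : Prop :=
  (∀ i, IsWeight (ω i)) ∧ ∃ C : ℝ≥0, ∀ (x : Rn n) (r : ℝ), 0 < r →
    (⨍⁻ y in ball x r, ∏ i, ENNReal.ofReal (ω i y) ^ (p / pv i) ∂volume) ^ (1 / p) *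
      ∏ i, (⨍⁻ y in ball x r,
        ENNReal.ofReal (ω i y) ^ (1 - pv i / (pv i - 1)) ∂volume) ^ (1 / (pv i / (pv i - 1))) ≤ C

/-! ### Function spaces -/

section Spaces

variable {𝕜 : Type*} [RCLike 𝕜] {n : ℕ}

/-- The average of `b` over the ball `B(x, r)`. -/
def ballAvg (b : Rn n → 𝕜) (x : Rn n) (r : ℝ) : 𝕜 := ⨍ y in ball x r, b y

/-- The seminorm `‖b‖_BMO`. -/
def bmoNorm (b : Rn n → 𝕜) : ℝ≥0∞ :=
  ⨆ (x : Rn n) (r : ℝ) (_ : 0 < r), ⨍⁻ y in ball x r, ‖b y - ballAvg b x r‖ₑ ∂volume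

/-- Membership in `BMO`. -/
def MemBMO (b : Rn n → 𝕜) : Prop :=
  LocallyIntegrable b volume ∧ bmoNorm b < ∞

/-- The generalized weighted Morrey norm
`sup_{x, r} φ(x,r)⁻¹ w(B(x,r))^{-1/p} ‖f‖_{L^p(B(x,r), w dx)}`. -/
def morreyNorm (p : ℝ) (φ : Rn n → ℝ → ℝ) (w : Rn n → ℝ) (f : Rn n → 𝕜) : ℝ≥0∞ :=
  ⨆ (x : Rn n) (r : ℝ) (_ : 0 < r),
    (ENNReal.ofReal (φ x r))⁻¹ * wt w (ball x r) ^ (-(1 / p)) *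
      (∫⁻ y in ball x r, ‖f y‖ₑ ^ p * ENNReal.ofReal (w y)) ^ (1 / p)

/-- The generalized weighted Morrey space `M^{p,φ}(w)`. -/
def morrey (𝕜 : Type*) [RCLike 𝕜] (p : ℝ) (φ : Rn n → ℝ → ℝ) (w : Rn n → ℝ) :
    Set (Rn n → 𝕜) :=
  {f | AEStronglyMeasurable f volume ∧ morreyNorm p φ w f < ∞}

/-- The space `X + bX = {g + b h : g, h ∈ X}`: the functions `(c - b) f`, with `c` a scalar and
`f ∈ X`, to which an operator is applied when its commutator with `b` is formed, lie in it. -/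
def commDomain (X : Set (Rn n → 𝕜)) (b : Rn n → 𝕜) : Set (Rn n → 𝕜) :=
  {f | ∃ g ∈ X, ∃ h ∈ X, f = fun y => g y + b y * h y}

end Spaces

/-- Positive measurable functions on `ℝⁿ × (0,∞)`. -/
def IsMorreyFun {n : ℕ} (φ : Rn n → ℝ → ℝ) : Prop :=
  (∀ x r, 0 < r → 0 < φ x r) ∧ Measurable fun z : Rn n × Ioi (0 : ℝ) => φ z.1 z.2

/-- The constant `[φ₁, φ₂]_2` of the log-weighted Hardy condition. -/
def hardyLogConst {n m : ℕ} (pv : Fin m → ℝ) (ω : Fin m → Rn n → ℝ)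
    (φ₁ : Fin m → Rn n → ℝ → ℝ) (φ₂ : Rn n → ℝ → ℝ) : ℝ≥0∞ :=
  ⨆ (x : Rn n) (r : ℝ) (_ : 0 < r), (ENNReal.ofReal (φ₂ x r))⁻¹ *
    ∫⁻ t in Ioi r, ENNReal.ofReal ((1 + Real.log (t / r)) ^ m) *
      (essInf (fun η : ℝ => ∏ i, ENNReal.ofReal (φ₁ i x η) * wt (ω i) (ball x η) ^ (1 / pv i))
          (volume.restrict (Ioi t)) /
        ∏ i, wt (ω i) (ball x t) ^ (1 / pv i)) * ENNReal.ofReal (1 / t)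

/-! ### Operators -/

section Operators

variable {𝕜 : Type*} [RCLike 𝕜] {n m : ℕ}

/-- `T` is an `m`-sublinear operator on `∏ D_i` with measurable values: in each slot `i`,
`|T(…, f_i + g, …)(x)| ≤ |T(…, f_i, …)(x)| + |T(…, g, …)(x)|` and
`|T(…, c f_i, …)(x)| = |c| |T(…, f_i, …)(x)|`.
The inequalities hold off a null set that may depend on the functions, but is common to all
functions of any given finite-dimensional subspaces `V_i ⊆ D_i`. -/
def IsMSublinear (D : Fin m → Set (Rn n → 𝕜)) (T : (Fin m → Rn n → 𝕜) → Rn n → 𝕜) : Prop :=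
  (∀ f : Fin m → Rn n → 𝕜, (∀ i, f i ∈ D i) → AEStronglyMeasurable (T f) volume) ∧
  ∀ V : Fin m → Submodule 𝕜 (Rn n → 𝕜), (∀ i, FiniteDimensional 𝕜 (V i)) →
    (∀ i, (V i : Set (Rn n → 𝕜)) ⊆ D i) →
    ∀ᵐ x : Rn n, ∀ f : Fin m → Rn n → 𝕜, (∀ i, f i ∈ V i) → ∀ i : Fin m,
      (∀ g ∈ V i, ‖T (Function.update f i (f i + g)) x‖ ≤
        ‖T f x‖ + ‖T (Function.update f i g) x‖) ∧
      (∀ c : 𝕜, ‖T (Function.update f i (c • f i)) x‖ = ‖c‖ * ‖T f x‖)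

/-- `f_i^∞ = f_i χ_{(2B)ᶜ}` in the slots `i ∈ S` and `f_i^0 = f_i χ_{2B}` in the other slots,
where `B = B(x, r)`. -/
def splitAt (S : Set (Fin m)) (x : Rn n) (r : ℝ) (f : Fin m → Rn n → 𝕜) : Fin m → Rn n → 𝕜 :=
  fun i y => by
    classical
    exact if i ∈ S then (ball x (2 * r))ᶜ.indicator (f i) y else (ball x (2 * r)).indicator (f i) y

/-- The local size condition `T ∈ LS(∏ D_i)` with constant `A`. -/
def LSWith (A : ℝ≥0) (D : Fin m → Set (Rn n → 𝕜)) (T : (Fin m → Rn n → 𝕜) → Rn n → 𝕜) : Prop :=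
  IsMSublinear D T ∧
  ∀ (x : Rn n) (r : ℝ), 0 < r → ∀ f : Fin m → Rn n → 𝕜, (∀ i, f i ∈ D i) →
    ∀ S : Set (Fin m), S.Nonempty →
      eLpNorm (T (splitAt S x r f)) ∞ (volume.restrict (ball x r)) ≤
        A * ∑' j : ℕ, ∏ i, (⨍⁻ y in ball x (2 ^ (j + 2) * r), ‖f i y‖ₑ ∂volume)

/-- The local size condition `T ∈ LS(∏ D_i)`. -/
def LS (D : Fin m → Set (Rn n → 𝕜)) (T : (Fin m → Rn n → 𝕜) → Rn n → 𝕜) : Prop :=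
  ∃ A : ℝ≥0, LSWith A D T

/-- The local boundedness condition with constant `A` for `T` from `∏ X_i`, with (quasi-)norms
`N_i`, to the space with (quasi-)norm `N`. -/
def LBWith (A : ℝ≥0∞) (X : Fin m → Set (Rn n → 𝕜)) (NX : Fin m → (Rn n → 𝕜) → ℝ≥0∞)
    (NY : (Rn n → 𝕜) → ℝ≥0∞) (T : (Fin m → Rn n → 𝕜) → Rn n → 𝕜) : Prop :=
  IsMSublinear X T ∧
  ∀ (x : Rn n) (r : ℝ), 0 < r → ∀ f : Fin m → Rn n → 𝕜, (∀ i, f i ∈ X i) →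
    NY (T (splitAt ∅ x r f)) ≤ A * ∏ i, NX i (f i)

/-- The local boundedness condition `T ∈ LB(∏ X_i → Y)`. -/
def LB (X : Fin m → Set (Rn n → 𝕜)) (NX : Fin m → (Rn n → 𝕜) → ℝ≥0∞)
    (NY : (Rn n → 𝕜) → ℝ≥0∞) (T : (Fin m → Rn n → 𝕜) → Rn n → 𝕜) : Prop :=
  ∃ A : ℝ≥0, LBWith A X NX NY T

/-- The iterated commutator
`T_{∏b}(f)(x) = T((b_1(x) - b_1) f_1, …, (b_m(x) - b_m) f_m)(x)`. -/
def iterComm (b : Fin m → Rn n → 𝕜) (T : (Fin m → Rn n → 𝕜) → Rn n → 𝕜) :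
    (Fin m → Rn n → 𝕜) → Rn n → 𝕜 :=
  fun f x => T (fun i y => (b i x - b i y) * f i y) x

end Operators

end MorreyComm

end

open MorreyComm

/-!
The bound is proved on one ball `B = B(x, r)` at a time, with `c i` the mean of `b i` over `B`.
Split each `f i` into its part in `2B` and its part off `2B` and expand `T` by sublinearity in every
slot. The term with all parts in `2B` is the local boundedness hypothesis. In every other term write
`b i (y) - b i = (b i (y) - c i) + (c i - b i)` and expand again; the size condition then bounds
`T` on `B` by a sum over the dyadic dilates of `B` of products of averages of `|f i|` or
`|c i - b i| |f i|` (`ae_enorm_iterComm_le`). Three facts finish the proof.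

* Under `A_P`, weights `ω i` in `A_∞` are in fact in `A_{p_i}`, one slot at a time
  (`MemAP.isDualPair`). Indeed `ω i ∈ A_{q_i}` for some `q_i`, and Hölder's inequality bounds
  `∏ ⟨ω i⟩ ^ (1 / p_i)` by `⟨∏ ω i ^ (p / p_i)⟩ ^ (1 / p)`. Hence the product over `i` of the
  `A_{p_i}` quotients is bounded, and each quotient is at least one. So `ω i` and
  `ω i ^ (1 - p_i')` form a pair of dual weights (`IsDualPair`), a notion symmetric in the two
  weights which yields doubling and the `A_∞` property for both.
* A John–Nirenberg inequality holds for such weights directly: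
  `∫_B |b - b_B| ^ q w ≤ (K ‖b‖) ^ q w(B)` (`IsDualPair.exists_lintegral_bmo_rpow_le`). The
  Calderón–Zygmund stopping cubes inside a cube carry at most half of its Lebesgue measure, hence at
  most a fixed fraction `β < 1` of its `w`-measure; iteration gives geometric decay of the level
  sets in `w`-measure (`measure_level_le`), with no reverse Hölder inequality. Applied to the dual
  weights of the `ω i` it controls the averages of `|c i - b i| |f i|` over dilates, applied to `v`
  it controls the factors `|b i (y) - c i|`.
* The dyadic sum is a discretization of the integral in the hypothesis on `φ₁` and `φ₂`
  (`exists_tsum_prod_le`).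
-/

open Filter Topology

namespace MorreyComm

variable {𝕜 : Type*} [RCLike 𝕜] {n m : ℕ}

theorem add_rpow_le_two_rpow_mul (s t : ℝ≥0∞) {q : ℝ} (hq : 0 ≤ q) :
    (s + t) ^ q ≤ 2 ^ q * (s ^ q + t ^ q) := by
  calc (s + t) ^ q ≤ (2 * max s t) ^ q := by
        rw [two_mul]; gcongr <;> simp
    _ = 2 ^ q * max s t ^ q := ENNReal.mul_rpow_of_nonneg _ _ hq
    _ ≤ _ := by
        gcongr
        rcases max_choice s t with h | h <;> rw [h]
        · exact le_self_add
        · exact le_add_self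

/-! ### Decay of level sets along a nested sequence of partitions -/

/-- The Calderón–Zygmund iteration behind the John–Nirenberg inequality, for an abstract nested
sequence of countable partitions: `π k x` names the cube of generation `k` containing `x`, and
`c k z` is a constant attached to the cube `z`. The constants converge to `f` at `w`-almost every
point. If the mean oscillation of `f` about these constants is at most `N`, the constants of a cube
and of its children differ by at most `D`, and a subset of at most half the `μ`-measure of a cube
has at most the fraction `β` of its `w`-measure, then the level sets of `f - c k z` in the cube
decay geometrically in `w`-measure. -/
theorem measure_level_le {X ι E : Type*} [MeasurableSpace X] [Countable ι]
    [NormedAddCommGroup E] {μ w : Measure X} {π : ℕ → X → ι}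
    (hmeas : ∀ k z, MeasurableSet (π k ⁻¹' {z}))
    (hnest : ∀ k x y, π (k + 1) x = π (k + 1) y → π k x = π k y)
    {f : X → E} (hf : AEStronglyMeasurable f μ) {c : ℕ → ι → E}
    (hlim : ∀ᵐ x ∂w, Tendsto (fun k => c k (π k x)) atTop (𝓝 (f x)))
    {N D : ℝ} (hN : 0 < N) (hD : 0 ≤ D)
    (hjump : ∀ k x, ‖c (k + 1) (π (k + 1) x) - c k (π k x)‖ ≤ D)
    (hosc : ∀ k z, ∫⁻ x in π k ⁻¹' {z}, ‖f x - c k z‖ₑ ∂μ ≤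
      ENNReal.ofReal N * μ (π k ⁻¹' {z}))
    (hfin : ∀ k z, μ (π k ⁻¹' {z}) ≠ ∞) {β : ℝ≥0∞}
    (hβ : ∀ k z, ∀ A ⊆ π k ⁻¹' {z}, MeasurableSet A → 2 * μ A ≤ μ (π k ⁻¹' {z}) →
      w A ≤ β * w (π k ⁻¹' {z})) (j : ℕ) :
    ∀ k z, w {x | π k x = z ∧ j * (3 * N + D) < ‖f x - c k z‖} ≤ β ^ j * w (π k ⁻¹' {z}) := by
  have hnest' : ∀ k l x y, π (k + l) x = π (k + l) y → π k x = π k y := by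
    intro k l
    induction l with
    | zero => intro x y h; exact h
    | succ l ih => intro x y h; exact ih x y (hnest (k + l) x y h)
  induction j with
  | zero =>
    intro k z
    simp only [pow_zero, one_mul]
    exact measure_mono fun x hx => hx.1
  | succ j ih =>
    intro k z
    -- `S l` is the set of points of the cube where the centers first leave the ball of
    -- radius `3 N` around `c k z` at generation `l`.
    set S : ℕ → Set X := fun l => {x | π k x = z ∧ 3 * N < ‖c (k + l) (π (k + l) x) - c k z‖ ∧
      ∀ l' < l, ‖c (k + l') (π (k + l') x) - c k z‖ ≤ 3 * N} with hS
    have hSsat : ∀ l x y, x ∈ S l → π (k + l) y = π (k + l) x → y ∈ S l := by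
      rintro l x y ⟨h1, h2, h3⟩ hxy
      refine ⟨(hnest' k l y x hxy).trans h1, by rw [hxy]; exact h2, fun l' hl' => ?_⟩
      have : π (k + l') y = π (k + l') x := by
        apply hnest' (k + l') (l - l')
        rwa [show k + l' + (l - l') = k + l by omega]
      rw [this]; exact h3 l' hl'
    let J : Set (ℕ × ι) := {q | ∃ x ∈ S q.1, π (k + q.1) x = q.2}
    let R : J → Set X := fun q => π (k + q.1.1) ⁻¹' {q.1.2}
    have hRS : ∀ q : J, R q ⊆ S q.1.1 := by
      rintro ⟨⟨l, ζ⟩, x, hx, hxζ⟩ y hy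
      exact hSsat l x y hx (by simpa [R, hxζ] using hy)
    have hRmeas : ∀ q, MeasurableSet (R q) := fun q => hmeas _ _
    have hRdisj : Pairwise (Function.onFun Disjoint R) := by
      intro q q' hqq'
      refine Set.disjoint_left.2 fun x hx hx' => hqq' ?_
      have h1 := hRS q hx
      have h2 := hRS q' hx'
      have hl : q.1.1 = q'.1.1 := by
        rcases lt_trichotomy q.1.1 q'.1.1 with h | h | h
        · exact absurd (h2.2.2 _ h) (not_le.2 h1.2.1)
        · exact h
        · exact absurd (h1.2.2 _ h) (not_le.2 h2.2.1)
      have hx1 : π (k + q.1.1) x = q.1.2 := hx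
      have hx2 : π (k + q'.1.1) x = q'.1.2 := hx'
      exact Subtype.ext (Prod.ext hl (by rw [← hx1, ← hx2, hl]))
    set P := π k ⁻¹' {z} with hP
    have hRP : (⋃ q, R q) ⊆ P := iUnion_subset fun q x hx => (hRS q hx).1
    have hRint : ∀ q : J, ENNReal.ofReal (2 * N) * μ (R q) ≤ ∫⁻ x in R q, ‖f x - c k z‖ₑ ∂μ := by
      intro q
      obtain ⟨x₀, hx₀, hx₀q⟩ := q.2
      have h3 : 3 * N < ‖c (k + q.1.1) q.1.2 - c k z‖ := by rw [← hx₀q]; exact hx₀.2.1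
      have h4 : ENNReal.ofReal (3 * N) * μ (R q) ≤
          ENNReal.ofReal N * μ (R q) + ∫⁻ x in R q, ‖f x - c k z‖ₑ ∂μ := by
        calc ENNReal.ofReal (3 * N) * μ (R q)
            = ∫⁻ x in R q, ENNReal.ofReal (3 * N) ∂μ := by simp
          _ ≤ ∫⁻ x in R q, (‖f x - c (k + q.1.1) q.1.2‖ₑ + ‖f x - c k z‖ₑ) ∂μ := by
              refine lintegral_mono fun x => ?_
              calc ENNReal.ofReal (3 * N) ≤ ‖c (k + q.1.1) q.1.2 - c k z‖ₑ := by
                    rw [← ofReal_norm]; exact ENNReal.ofReal_le_ofReal h3.le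
                _ ≤ _ := by
                    rw [← enorm_neg (f x - c (k + q.1.1) q.1.2)]
                    refine le_trans (le_of_eq ?_) (enorm_add_le _ _)
                    congr 1; abel
          _ = ∫⁻ x in R q, ‖f x - c (k + q.1.1) q.1.2‖ₑ ∂μ + ∫⁻ x in R q, ‖f x - c k z‖ₑ ∂μ :=
              lintegral_add_left' (hf.restrict.sub aestronglyMeasurable_const).enorm _
          _ ≤ _ := by gcongr; exact hosc _ _
      have h5 : ENNReal.ofReal (3 * N) * μ (R q) =
          ENNReal.ofReal N * μ (R q) + ENNReal.ofReal (2 * N) * μ (R q) := by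
        rw [← add_mul, ← ENNReal.ofReal_add hN.le (by positivity)]
        congr 2; ring
      rw [h5] at h4
      exact (ENNReal.add_le_add_iff_left (ENNReal.mul_ne_top ENNReal.ofReal_ne_top (hfin _ _))).1 h4
    -- On a stopping cube the mean oscillation about `c k z` is at least `3 N - N`, so the stopping
    -- cubes together have at most half the measure of `P`.
    have hhalf : 2 * μ (⋃ q, R q) ≤ μ P := by
      have h6 : ENNReal.ofReal N * (2 * μ (⋃ q, R q)) ≤ ENNReal.ofReal N * μ P := by
        calc ENNReal.ofReal N * (2 * μ (⋃ q, R q))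
            = ∑' q, ENNReal.ofReal (2 * N) * μ (R q) := by
              rw [measure_iUnion hRdisj hRmeas, ENNReal.tsum_mul_left,
                ENNReal.ofReal_mul (by norm_num), ENNReal.ofReal_ofNat]; ring
          _ ≤ ∑' q, ∫⁻ x in R q, ‖f x - c k z‖ₑ ∂μ := ENNReal.tsum_le_tsum hRint
          _ = ∫⁻ x in ⋃ q, R q, ‖f x - c k z‖ₑ ∂μ := (lintegral_iUnion hRmeas hRdisj _).symm
          _ ≤ ∫⁻ x in P, ‖f x - c k z‖ₑ ∂μ := lintegral_mono_set hRP
          _ ≤ _ := hosc k z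
      exact (ENNReal.mul_le_mul_iff_right (by simpa using hN) ENNReal.ofReal_ne_top).1 h6
    -- A point where `f` is far from `c k z` lies in a stopping cube, whose constant is within
    -- `3 N + D` of `c k z` since its parent did not stop.
    have hcover : ∀ᵐ x ∂w, x ∈ {x | π k x = z ∧ ((j + 1 : ℕ) : ℝ) * (3 * N + D) < ‖f x - c k z‖} →
        x ∈ ⋃ q : J, {x | π (k + q.1.1) x = q.1.2 ∧
          j * (3 * N + D) < ‖f x - c (k + q.1.1) q.1.2‖} := by
      filter_upwards [hlim] with x hx hxz
      obtain ⟨hxz, hxj⟩ := hxz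
      push_cast at hxj
      have hex : ∃ l, 3 * N < ‖c (k + l) (π (k + l) x) - c k z‖ := by
        by_contra! hcon
        have ht : Tendsto (fun l => ‖c (k + l) (π (k + l) x) - c k z‖) atTop
            (𝓝 ‖f x - c k z‖) := by
          have := hx.comp (tendsto_add_atTop_nat k)
          refine ((this.congr fun l => ?_).sub_const (c k z)).norm
          simp [add_comm]
        have h7 := le_of_tendsto' ht hcon
        have h8 : 0 ≤ (j : ℝ) * (3 * N + D) := by positivity
        nlinarith
      classical
      let l := Nat.find hex
      have hl1 : 3 * N < ‖c (k + l) (π (k + l) x) - c k z‖ := Nat.find_spec hex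
      have hl2 : ∀ l' < l, ‖c (k + l') (π (k + l') x) - c k z‖ ≤ 3 * N :=
        fun l' hl' => not_lt.1 (Nat.find_min hex hl')
      have hxS : x ∈ S l := ⟨hxz, hl1, hl2⟩
      have hl0 : l ≠ 0 := by
        intro h0
        rw [h0, add_zero, hxz, sub_self, norm_zero] at hl1
        linarith
      obtain ⟨l', hl'⟩ := Nat.exists_eq_succ_of_ne_zero hl0
      have h9 : ‖c (k + l) (π (k + l) x) - c k z‖ ≤ 3 * N + D := by
        have h10 := hl2 l' (by omega)
        have h11 := hjump (k + l') x
        rw [hl', Nat.succ_eq_add_one, ← add_assoc]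
        calc _ ≤ ‖c (k + l' + 1) (π (k + l' + 1) x) - c (k + l') (π (k + l') x)‖ +
              ‖c (k + l') (π (k + l') x) - c k z‖ := norm_sub_le_norm_sub_add_norm_sub _ _ _
          _ ≤ _ := by linarith
      refine mem_iUnion.2 ⟨⟨(l, π (k + l) x), x, hxS, rfl⟩, rfl, ?_⟩
      have h12 : ‖f x - c k z‖ ≤ ‖f x - c (k + l) (π (k + l) x)‖ +
          ‖c (k + l) (π (k + l) x) - c k z‖ := norm_sub_le_norm_sub_add_norm_sub _ _ _
      change (j : ℝ) * (3 * N + D) < ‖f x - c (k + l) (π (k + l) x)‖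
      nlinarith
    calc w {x | π k x = z ∧ ((j + 1 : ℕ) : ℝ) * (3 * N + D) < ‖f x - c k z‖}
        ≤ w (⋃ q : J, {x | π (k + q.1.1) x = q.1.2 ∧
          j * (3 * N + D) < ‖f x - c (k + q.1.1) q.1.2‖}) := measure_mono_ae hcover
      _ ≤ ∑' q : J, w {x | π (k + q.1.1) x = q.1.2 ∧
          j * (3 * N + D) < ‖f x - c (k + q.1.1) q.1.2‖} := measure_iUnion_le _
      _ ≤ ∑' q : J, β ^ j * w (R q) := ENNReal.tsum_le_tsum fun q => ih _ _
      _ = β ^ j * w (⋃ q, R q) := by rw [ENNReal.tsum_mul_left, measure_iUnion hRdisj hRmeas]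
      _ ≤ β ^ j * (β * w P) := by
          gcongr
          exact hβ k z _ hRP (MeasurableSet.iUnion hRmeas) hhalf
      _ = β ^ (j + 1) * w P := by rw [pow_succ, mul_assoc]

/-- Geometric decay of the level sets of `g` bounds all its moments. -/
theorem lintegral_rpow_le_of_level {X : Type*} [MeasurableSpace X] {w : Measure X} {g : X → ℝ}
    (hg : AEMeasurable g w) {Λ q : ℝ} (hΛ : 0 < Λ) (hq : 0 < q) {β M : ℝ≥0∞}
    (h : ∀ j : ℕ, w {x | j * Λ < g x} ≤ β ^ j * M) :
    ∫⁻ x, ENNReal.ofReal (g x) ^ q ∂w ≤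
      (∑' j : ℕ, ((j : ℝ≥0∞) + 1) ^ q * β ^ j) * ENNReal.ofReal Λ ^ q * M := by
  have hpt : ∀ x, ENNReal.ofReal (g x) ^ q ≤ ∑' j : ℕ, {x | j * Λ < g x}.indicator
      (fun _ => (((j : ℝ≥0∞) + 1) * ENNReal.ofReal Λ) ^ q) x := by
    intro x
    rcases le_or_gt (g x) 0 with hx | hx
    · simp [ENNReal.ofReal_of_nonpos hx, hq]
    · set k := ⌈g x / Λ⌉₊ with hk
      have hk0 : 0 < k := Nat.ceil_pos.2 (by positivity)
      have hk1 : ((k - 1 : ℕ) : ℝ) * Λ < g x := by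
        have h1 : ((k - 1 : ℕ) : ℝ) < g x / Λ := Nat.lt_ceil.1 (by omega)
        rwa [lt_div_iff₀ hΛ] at h1
      have hk2 : g x ≤ k * Λ := by
        have := Nat.le_ceil (g x / Λ)
        rwa [div_le_iff₀ hΛ] at this
      refine le_trans ?_ (ENNReal.le_tsum (k - 1))
      rw [indicator_of_mem (by exact hk1)]
      refine ENNReal.rpow_le_rpow ?_ hq.le
      calc ENNReal.ofReal (g x) ≤ ENNReal.ofReal (k * Λ) := ENNReal.ofReal_le_ofReal hk2
        _ = k * ENNReal.ofReal Λ := by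
          rw [ENNReal.ofReal_mul (by positivity), ENNReal.ofReal_natCast]
        _ = _ := by congr 1; exact_mod_cast (Nat.sub_add_cancel hk0).symm
  have hm : ∀ j : ℕ, NullMeasurableSet {x | j * Λ < g x} w := fun j =>
    nullMeasurableSet_lt aemeasurable_const hg
  calc ∫⁻ x, ENNReal.ofReal (g x) ^ q ∂w
      ≤ ∫⁻ x, ∑' j : ℕ, {x | j * Λ < g x}.indicator
          (fun _ => (((j : ℝ≥0∞) + 1) * ENNReal.ofReal Λ) ^ q) x ∂w := lintegral_mono hpt
    _ = ∑' j : ℕ, (((j : ℝ≥0∞) + 1) * ENNReal.ofReal Λ) ^ q * w {x | j * Λ < g x} := by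
        rw [lintegral_tsum fun j => (aemeasurable_const.indicator₀ (hm j))]
        exact tsum_congr fun j => lintegral_indicator_const₀ (hm j) _
    _ ≤ ∑' j : ℕ, (((j : ℝ≥0∞) + 1) * ENNReal.ofReal Λ) ^ q * (β ^ j * M) :=
        ENNReal.tsum_le_tsum fun j => by gcongr; exact h j
    _ = _ := by
        rw [← ENNReal.tsum_mul_right, ← ENNReal.tsum_mul_right]
        refine tsum_congr fun j => ?_
        rw [ENNReal.mul_rpow_of_nonneg _ _ hq.le]; ring

theorem tsum_rpow_mul_geometric_lt_top {β : ℝ≥0∞} (hβ : β < 1) {q : ℝ} :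
    ∑' j : ℕ, ((j : ℝ≥0∞) + 1) ^ q * β ^ j < ∞ := by
  lift β to ℝ≥0 using (hβ.trans ENNReal.one_lt_top).ne
  have hβ' : (β : ℝ) < 1 := by exact_mod_cast hβ
  set k := ⌈q⌉₊
  have hs : Summable fun j : ℕ => ((j : ℝ≥0) + 1) ^ k * β ^ (j + 1) := by
    have h1 := summable_pow_mul_geometric_of_norm_lt_one (R := ℝ) k (r := β) (by simpa using hβ')
    have h2 := (summable_nat_add_iff 1).2 h1
    rw [← NNReal.summable_coe]
    simpa using h2
  -- The summability at hand has the factor `β ^ (j + 1)`; one power of `β` is cancelled, so the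
  -- case `β = 0` is separate.
  rcases eq_or_ne β 0 with rfl | h0
  · rw [tsum_eq_single 0]
    · simp
    · intro j hj; simp [hj]
  have hs' : Summable fun j : ℕ => ((j : ℝ≥0) + 1) ^ k * β ^ j := by
    refine (summable_mul_right_iff (f := fun j : ℕ => ((j : ℝ≥0) + 1) ^ k * β ^ j) h0).1 ?_
    simpa [pow_succ, mul_assoc] using hs
  refine lt_of_le_of_lt (ENNReal.tsum_le_tsum fun j => ?_)
    (ENNReal.tsum_coe_ne_top_iff_summable.2 hs').lt_top
  push_cast
  gcongr
  rw [← ENNReal.rpow_natCast]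
  exact ENNReal.rpow_le_rpow_of_exponent_le (by simp) (Nat.le_ceil q)

/-! ### Balls in Euclidean space -/

theorem volume_ball_mul {c : ℝ} (hc : 0 < c) (x y : Rn n) (r : ℝ) :
    volume (ball x (c * r)) = ENNReal.ofReal (c ^ n) * volume (ball y r) := by
  rw [Measure.addHaar_ball_mul_of_pos _ _ hc, Measure.addHaar_ball_center _ y,
    finrank_euclideanSpace_fin]

theorem volume_ball_ne_zero (x : Rn n) {r : ℝ} (hr : 0 < r) : volume (ball x r) ≠ 0 :=
  (measure_ball_pos _ _ hr).ne'

theorem volume_ball_ne_top (x : Rn n) (r : ℝ) : volume (ball x r) ≠ ∞ :=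
  measure_ball_lt_top.ne

theorem laverage_mul_volume_ball (f : Rn n → ℝ≥0∞) (x : Rn n) {r : ℝ} (hr : 0 < r) :
    (⨍⁻ y in ball x r, f y ∂volume) * volume (ball x r) = ∫⁻ y in ball x r, f y := by
  rw [setLAverage_eq, ENNReal.div_mul_cancel (volume_ball_ne_zero x hr) (volume_ball_ne_top x r)]

theorem locallyIntegrable_integrableOn_ball {E : Type*} [NormedAddCommGroup E] {f : Rn n → E}
    (hf : LocallyIntegrable f volume) (x : Rn n) (r : ℝ) : IntegrableOn f (ball x r) :=
  (hf.integrableOn_isCompact (isCompact_closedBall x r)).mono_set ball_subset_closedBall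

/-! ### Mean oscillation -/

theorem lintegral_sub_ballAvg_le (f : Rn n → 𝕜) (x : Rn n) {r : ℝ} (hr : 0 < r) :
    ∫⁻ y in ball x r, ‖f y - ballAvg f x r‖ₑ ≤ bmoNorm f * volume (ball x r) := by
  rw [← laverage_mul_volume_ball _ x hr]
  gcongr
  exact le_iSup_of_le x (le_iSup_of_le r (le_iSup_of_le hr le_rfl))

theorem enorm_ballAvg_sub_le {f : Rn n → 𝕜} (hf : LocallyIntegrable f volume) {x x' : Rn n}
    {r r' : ℝ} (hr : 0 < r) (hr' : 0 < r') (hsub : ball x r ⊆ ball x' r') {K : ℝ≥0∞}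
    (hK : volume (ball x' r') ≤ K * volume (ball x r)) :
    ‖ballAvg f x r - ballAvg f x' r'‖ₑ ≤ K * bmoNorm f := by
  set c := ballAvg f x' r'
  have h0 := volume_ball_ne_zero x hr
  have h1 := volume_ball_ne_top x r
  have hint := locallyIntegrable_integrableOn_ball hf x r
  have h2 : volume.real (ball x r) • (ballAvg f x r - c) = ∫ y in ball x r, (f y - c) := by
    rw [integral_sub hint (integrableOn_const h1), setIntegral_const, smul_sub, ballAvg,
      setAverage_eq, smul_smul, mul_inv_cancel₀, one_smul]
    simp [Measure.real, ENNReal.toReal_eq_zero_iff, h0, h1]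
  have h3 : volume (ball x r) * ‖ballAvg f x r - c‖ₑ ≤ volume (ball x r) * (K * bmoNorm f) := by
    calc volume (ball x r) * ‖ballAvg f x r - c‖ₑ
        = ‖∫ y in ball x r, (f y - c)‖ₑ := by
          rw [← h2, enorm_smul, Real.enorm_of_nonneg measureReal_nonneg, ofReal_measureReal h1]
      _ ≤ ∫⁻ y in ball x r, ‖f y - c‖ₑ := enorm_integral_le_lintegral_enorm _
      _ ≤ ∫⁻ y in ball x' r', ‖f y - c‖ₑ := lintegral_mono_set hsub
      _ ≤ bmoNorm f * volume (ball x' r') := lintegral_sub_ballAvg_le f x' hr'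
      _ ≤ bmoNorm f * (K * volume (ball x r)) := by gcongr
      _ = _ := by ring
  exact (ENNReal.mul_le_mul_iff_right h0 h1).1 h3

/-! ### Pairs of dual weights -/

/-- A pair of dual weights with exponents `a + b = 1`. For a weight `u` and `s = u ^ (1 - q')`,
`a = 1 / q`, `b = 1 / q'`, the last field is the condition `u ∈ A_q`. Only the inequality
`1 ≤ u ^ a * s ^ b` is kept of the relation between `u` and `s`, and the notion is symmetric under
exchanging `(u, a)` with `(s, b)`, so that whatever is proved for `u` holds for `s` too. -/
structure IsDualPair (u s : Rn n → ℝ≥0∞) (a b : ℝ) (C : ℝ≥0) : Prop where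
  aemeas : AEMeasurable u
  aemeas' : AEMeasurable s
  pos : 0 < a
  pos' : 0 < b
  add_eq : a + b = 1
  one_le : ∀ᵐ x, 1 ≤ u x ^ a * s x ^ b
  le : ∀ (x : Rn n) (r : ℝ), 0 < r →
    (∫⁻ y in ball x r, u y) ^ a * (∫⁻ y in ball x r, s y) ^ b ≤ C * volume (ball x r)

namespace IsDualPair

variable {u s : Rn n → ℝ≥0∞} {a b : ℝ} {C : ℝ≥0}

theorem symm (h : IsDualPair u s a b C) : IsDualPair s u b a C where
  aemeas := h.aemeas'
  aemeas' := h.aemeas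
  pos := h.pos'
  pos' := h.pos
  add_eq := by rw [add_comm]; exact h.add_eq
  one_le := by simpa only [mul_comm] using h.one_le
  le := by simpa only [mul_comm ((∫⁻ y in ball _ _, s y) ^ b)] using h.le

theorem volume_le (h : IsDualPair u s a b C) (A : Set (Rn n)) :
    volume A ≤ (∫⁻ y in A, u y) ^ a * (∫⁻ y in A, s y) ^ b := by
  calc volume A = ∫⁻ _ in A, 1 := by simp
    _ ≤ ∫⁻ y in A, u y ^ a * s y ^ b := lintegral_mono_ae (ae_restrict_of_ae h.one_le)
    _ ≤ _ := ENNReal.lintegral_mul_norm_pow_le h.aemeas.restrict h.aemeas'.restrict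
        h.pos.le h.pos'.le h.add_eq

theorem lintegral_ne_zero (h : IsDualPair u s a b C) (x : Rn n) {r : ℝ} (hr : 0 < r) :
    ∫⁻ y in ball x r, u y ≠ 0 := by
  intro h0
  have := h.volume_le (ball x r)
  rw [h0, ENNReal.zero_rpow_of_pos h.pos, zero_mul] at this
  exact volume_ball_ne_zero x hr (le_antisymm this zero_le)

theorem lintegral_ne_top (h : IsDualPair u s a b C) (x : Rn n) {r : ℝ} (hr : 0 < r) :
    ∫⁻ y in ball x r, u y ≠ ∞ := by
  intro h0
  have h1 := h.le x r hr
  rw [h0, ENNReal.top_rpow_of_pos h.pos, ENNReal.top_mul] at h1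
  · exact ENNReal.mul_ne_top ENNReal.coe_ne_top (volume_ball_ne_top x r) (top_le_iff.1 h1)
  · simp [ENNReal.rpow_eq_zero_iff, h.symm.lintegral_ne_zero x hr, h.pos'.not_gt]

/-- The quantitative comparison `|A| / |B| ≤ C (u(A) / u(B)) ^ a` for subsets of a ball, in a form
without division. -/
theorem volume_mul_le (h : IsDualPair u s a b C) {x : Rn n} {r : ℝ} (hr : 0 < r)
    {A : Set (Rn n)} (hA : A ⊆ ball x r) :
    volume A * (∫⁻ y in ball x r, u y) ^ a ≤
      C * volume (ball x r) * (∫⁻ y in A, u y) ^ a := by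
  calc volume A * (∫⁻ y in ball x r, u y) ^ a
      ≤ ((∫⁻ y in A, u y) ^ a * (∫⁻ y in A, s y) ^ b) * (∫⁻ y in ball x r, u y) ^ a := by
        gcongr; exact h.volume_le A
    _ ≤ ((∫⁻ y in A, u y) ^ a * (∫⁻ y in ball x r, s y) ^ b) *
          (∫⁻ y in ball x r, u y) ^ a := by
        have := h.pos'.le
        gcongr
    _ = (∫⁻ y in A, u y) ^ a *
        ((∫⁻ y in ball x r, u y) ^ a * (∫⁻ y in ball x r, s y) ^ b) := by ring
    _ ≤ (∫⁻ y in A, u y) ^ a * (C * volume (ball x r)) := by exact mul_le_mul_right (h.le x r hr) _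
    _ = _ := by ring

theorem lintegral_le_of_volume_le (h : IsDualPair u s a b C) {x : Rn n} {r : ℝ} (hr : 0 < r)
    {A : Set (Rn n)} (hA : A ⊆ ball x r) {K : ℝ≥0∞} (hK : volume (ball x r) ≤ K * volume A) :
    ∫⁻ y in ball x r, u y ≤ (C * K) ^ (1 / a) * ∫⁻ y in A, u y := by
  have hA0 : volume A ≠ 0 := by
    intro h0
    rw [h0, mul_zero] at hK
    exact volume_ball_ne_zero x hr (le_antisymm hK zero_le)
  have hA1 : volume A ≠ ∞ := ((measure_mono hA).trans_lt measure_ball_lt_top).ne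
  have h1 : volume A * (∫⁻ y in ball x r, u y) ^ a ≤
      volume A * (C * K * (∫⁻ y in A, u y) ^ a) := by
    calc _ ≤ C * volume (ball x r) * (∫⁻ y in A, u y) ^ a := h.volume_mul_le hr hA
      _ ≤ C * (K * volume A) * (∫⁻ y in A, u y) ^ a := by gcongr
      _ = _ := by ring
  have h2 := (ENNReal.mul_le_mul_iff_right hA0 hA1).1 h1
  have h3 := ENNReal.rpow_le_rpow h2 (one_div_pos.2 h.pos).le
  rwa [ENNReal.mul_rpow_of_nonneg _ _ (one_div_pos.2 h.pos).le, ← ENNReal.rpow_mul,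
    ← ENNReal.rpow_mul, mul_one_div_cancel h.pos.ne', ENNReal.rpow_one, ENNReal.rpow_one] at h3

theorem lintegral_ball_mul_le (h : IsDualPair u s a b C) {c : ℝ} (hc : 1 ≤ c) (x : Rn n) {r : ℝ}
    (hr : 0 < r) : ∫⁻ y in ball x (c * r), u y ≤
      (C * ENNReal.ofReal (c ^ n)) ^ (1 / a) * ∫⁻ y in ball x r, u y :=
  h.lintegral_le_of_volume_le (by positivity) (ball_subset_ball (by nlinarith))
    (volume_ball_mul (by positivity) _ _ _).le

end IsDualPair

/-! ### Dyadic cubes -/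

/-- The index of the dyadic cube of generation `k`, of side `L / 2 ^ k`, that contains `x`, in the
grid of half-open cubes with origin `a`. -/
noncomputable def gridIndex (a : Rn n) (L : ℝ) (k : ℕ) (x : Rn n) : Fin n → ℤ :=
  fun i => ⌊(x i - a i) / (L / 2 ^ k)⌋

/-- The center of the cube with index `z` of generation `k`. -/
noncomputable def gridCenter (a : Rn n) (L : ℝ) (k : ℕ) (z : Fin n → ℤ) : Rn n :=
  WithLp.toLp 2 fun i => a i + (z i + 1 / 2) * (L / 2 ^ k)

theorem measurable_gridIndex (a : Rn n) (L : ℝ) (k : ℕ) : Measurable (gridIndex a L k) := by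
  refine measurable_pi_lambda _ fun i => Int.measurable_floor.comp ?_
  fun_prop

theorem gridIndex_nested (a : Rn n) (L : ℝ) (k : ℕ) (x y : Rn n)
    (h : gridIndex a L (k + 1) x = gridIndex a L (k + 1) y) :
    gridIndex a L k x = gridIndex a L k y := by
  have key : ∀ x : Rn n, ∀ i, gridIndex a L k x i = gridIndex a L (k + 1) x i / 2 := by
    intro x i
    have := Int.floor_div_natCast ((x i - a i) / (L / 2 ^ (k + 1))) 2
    simp only [gridIndex]
    push_cast at this
    rw [← this, pow_succ]
    congr 1
    rw [div_div_eq_mul_div, div_div_eq_mul_div]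
    ring
  ext i
  rw [key, key, h]

theorem gridIndex_eq_iff (a : Rn n) {L : ℝ} (hL : 0 < L) (k : ℕ) (z : Fin n → ℤ) (x : Rn n) :
    gridIndex a L k x = z ↔
      ∀ i, x i ∈ Ico (a i + z i * (L / 2 ^ k)) (a i + (z i + 1) * (L / 2 ^ k)) := by
  have hh : 0 < L / 2 ^ k := by positivity
  rw [funext_iff]
  refine forall_congr' fun i => ?_
  rw [gridIndex, Int.floor_eq_iff, le_div_iff₀ hh, div_lt_iff₀ hh, mem_Ico]
  constructor <;> rintro ⟨h1, h2⟩ <;> constructor <;> linarith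

theorem volume_gridCube (a : Rn n) {L : ℝ} (hL : 0 < L) (k : ℕ) (z : Fin n → ℤ) :
    volume (gridIndex a L k ⁻¹' {z}) = ENNReal.ofReal ((L / 2 ^ k) ^ n) := by
  have h1 : gridIndex a L k ⁻¹' {z} = WithLp.ofLp ⁻¹' (Set.univ.pi fun i =>
      Ico (a i + z i * (L / 2 ^ k)) (a i + (z i + 1) * (L / 2 ^ k))) := by
    ext x
    simp only [mem_preimage, mem_singleton_iff, gridIndex_eq_iff a hL, mem_univ_pi]
  rw [h1, (PiLp.volume_preserving_ofLp (Fin n)).measure_preimage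
    (MeasurableSet.univ_pi fun i => measurableSet_Ico).nullMeasurableSet, Real.volume_pi_Ico]
  simp only [show ∀ t : ℝ, ∀ w : ℝ, t + (w + 1) * (L / 2 ^ k) - (t + w * (L / 2 ^ k)) = L / 2 ^ k
    from fun t w => by ring]
  rw [Finset.prod_const, ENNReal.ofReal_pow (by positivity)]
  simp

theorem norm_le_of_forall_abs_le {x : Rn n} {h : ℝ} (hh : 0 ≤ h) (hx : ∀ i, |x i| ≤ h) :
    ‖x‖ ≤ n * h := by
  rcases Nat.eq_zero_or_pos n with rfl | hn
  · simp [Subsingleton.elim x 0]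
  rw [EuclideanSpace.norm_eq]
  refine Real.sqrt_le_iff.2 ⟨by positivity, ?_⟩
  calc ∑ i, ‖x i‖ ^ 2 ≤ ∑ _i : Fin n, h ^ 2 := Finset.sum_le_sum fun i _ => by
        rw [Real.norm_eq_abs]; gcongr; exact hx i
    _ = n * h ^ 2 := by simp
    _ ≤ (n * h) ^ 2 := by
        have : (1 : ℝ) ≤ n := by exact_mod_cast hn
        rw [mul_pow]
        gcongr
        nlinarith

theorem norm_sub_gridCenter_le (a : Rn n) {L : ℝ} (hL : 0 < L) (k : ℕ) (x : Rn n) :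
    ‖x - gridCenter a L k (gridIndex a L k x)‖ ≤ n * (L / 2 ^ k / 2) := by
  have hh : 0 < L / 2 ^ k := by positivity
  refine norm_le_of_forall_abs_le (by positivity) fun i => ?_
  have := (gridIndex_eq_iff a hL k _ x).1 rfl i
  simp only [gridCenter, PiLp.sub_apply]
  rw [abs_le]
  constructor <;> nlinarith [this.1, this.2]

/-! ### Balls circumscribed about dyadic cubes -/

theorem gridCube_subset_ball (hn : 1 ≤ n) (a : Rn n) {L : ℝ} (hL : 0 < L) (k : ℕ)
    (z : Fin n → ℤ) :
    gridIndex a L k ⁻¹' {z} ⊆ ball (gridCenter a L k z) (2 * n * (L / 2 ^ k)) := by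
  rintro x rfl
  have hn' : (1 : ℝ) ≤ n := by exact_mod_cast hn
  have hh : 0 < L / 2 ^ k := by positivity
  rw [mem_ball, dist_eq_norm]
  refine (norm_sub_gridCenter_le a hL k x).trans_lt ?_
  nlinarith [mul_pos (zero_lt_one.trans_le hn') hh]

/-- The balls circumscribed about the cubes are nested along with the cubes: the radius, `2 n`
times the side, leaves room for the distance between the centers. -/
theorem gridBall_subset (a : Rn n) {L : ℝ} (hL : 0 < L) (k : ℕ) (x : Rn n) :
    ball (gridCenter a L (k + 1) (gridIndex a L (k + 1) x)) (2 * n * (L / 2 ^ (k + 1))) ⊆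
      ball (gridCenter a L k (gridIndex a L k x)) (2 * n * (L / 2 ^ k)) := by
  refine ball_subset_ball' ?_
  have h1 := norm_sub_gridCenter_le a hL k x
  have h2 := norm_sub_gridCenter_le a hL (k + 1) x
  have h3 := norm_sub_le_norm_sub_add_norm_sub
    (gridCenter a L (k + 1) (gridIndex a L (k + 1) x)) x
    (gridCenter a L k (gridIndex a L k x))
  rw [norm_sub_rev _ x] at h3
  rw [dist_eq_norm]
  have h4 : L / 2 ^ (k + 1) = L / 2 ^ k / 2 := by rw [pow_succ, div_div]
  rw [h4] at h2 ⊢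
  have hh : 0 ≤ n * (L / 2 ^ k) := by positivity
  nlinarith

/-- Lebesgue differentiation along the balls circumscribed about the dyadic cubes containing a
point. -/
theorem ae_tendsto_ballAvg {f : Rn n → 𝕜} (hn : 1 ≤ n) (hf : LocallyIntegrable f volume)
    (a : Rn n) {L : ℝ} (hL : 0 < L) :
    ∀ᵐ x, Tendsto (fun k => ballAvg f (gridCenter a L k (gridIndex a L k x))
      (2 * n * (L / 2 ^ k))) atTop (𝓝 (f x)) := by
  have : Nonempty (Fin n) := ⟨⟨0, hn⟩⟩
  have hn' : (1 : ℝ) ≤ n := by exact_mod_cast hn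
  filter_upwards [IsUnifLocDoublingMeasure.ae_tendsto_average volume hf 1] with x hx
  have h1 := hx (l := atTop) (fun k : ℕ => gridCenter a L k (gridIndex a L k x))
    (fun k => 2 * n * (L / 2 ^ k)) ?_ ?_
  · refine h1.congr fun k => ?_
    rw [ballAvg]
    have : closedBall (gridCenter a L k (gridIndex a L k x)) (2 * n * (L / 2 ^ k)) =ᵐ[volume]
        ball (gridCenter a L k (gridIndex a L k x)) (2 * n * (L / 2 ^ k)) := by
      refine (ae_eq_of_subset_of_measure_ge ball_subset_closedBall
        (Measure.addHaar_closedBall_eq_addHaar_ball _ _ _).le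
        measurableSet_ball.nullMeasurableSet measure_closedBall_lt_top.ne).symm
    exact setAverage_congr this
  · rw [tendsto_nhdsWithin_iff]
    refine ⟨?_, Eventually.of_forall fun k => by simp only [mem_Ioi]; positivity⟩
    have h2 : Tendsto (fun k : ℕ => 2 * n * L * (1 / 2 : ℝ) ^ k) atTop (𝓝 (2 * n * L * 0)) :=
      (tendsto_pow_atTop_nhds_zero_of_lt_one (by norm_num) (by norm_num)).const_mul _
    rw [mul_zero] at h2
    refine h2.congr fun k => ?_
    rw [one_div, inv_pow]; ring
  · refine Eventually.of_forall fun k => ball_subset_closedBall ?_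
    rw [one_mul]
    exact gridCube_subset_ball hn a hL k _ rfl

theorem volume_gridBall (a : Rn n) {L : ℝ} (hL : 0 < L) (k : ℕ) (z : Fin n → ℤ) (hn : 1 ≤ n) :
    volume (ball (gridCenter a L k z) (2 * n * (L / 2 ^ k))) =
      ENNReal.ofReal ((2 * n) ^ n) * volume (ball (0 : Rn n) 1) *
        volume (gridIndex a L k ⁻¹' {z}) := by
  have hn' : (1 : ℝ) ≤ n := by exact_mod_cast hn
  rw [volume_gridCube a hL, volume_ball_mul (by positivity) _ 0, mul_assoc,
    mul_comm (volume (ball (0 : Rn n) 1)),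

    ← volume_ball_mul (n := n) (show 0 < L / 2 ^ k by positivity) 0 0 1, mul_one]

/-! ### The weighted John–Nirenberg inequality -/

namespace IsDualPair

variable {u s : Rn n → ℝ≥0∞} {a b : ℝ} {C : ℝ≥0}

/-- The `A_∞` property: a subset with at most half the volume of `P` carries at most a fixed
fraction of the weight of `P`, because its complement in `P` carries at least a fixed fraction. -/
theorem lintegral_le_mul_of_two_mul_volume_le (h : IsDualPair u s a b C) {x : Rn n} {r : ℝ}
    (hr : 0 < r) {P : Set (Rn n)} (hP : P ⊆ ball x r) {K : ℝ≥0}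
    (hK : volume (ball x r) ≤ K * volume P) {A : Set (Rn n)} (hA : A ⊆ P)
    (hAm : MeasurableSet A) (hAP : 2 * volume A ≤ volume P) :
    ∫⁻ y in A, u y ≤ (1 - ((C * (2 * K) : ℝ≥0∞) ^ (1 / a))⁻¹) * ∫⁻ y in P, u y := by
  have hPtop : volume P ≠ ∞ := ((measure_mono hP).trans_lt measure_ball_lt_top).ne
  have hAtop : volume A ≠ ∞ := ((measure_mono hA).trans_lt hPtop.lt_top).ne
  have h1 : volume P ≤ 2 * volume (P \ A) := by
    have h2 : volume P = volume A + volume (P \ A) := by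
      rw [measure_sdiff hA hAm.nullMeasurableSet hAtop, add_tsub_cancel_of_le (measure_mono hA)]
    rw [h2, two_mul] at hAP
    have := (ENNReal.add_le_add_iff_left hAtop).1 hAP
    rw [h2, two_mul]; gcongr
  have h3 : ∫⁻ y in ball x r, u y ≤ (C * (2 * K)) ^ (1 / a) * ∫⁻ y in P \ A, u y := by
    refine h.lintegral_le_of_volume_le hr (sdiff_subset.trans hP) (hK.trans ?_)
    calc (K : ℝ≥0∞) * volume P ≤ K * (2 * volume (P \ A)) := by gcongr
      _ = _ := by ring
  have h4 : ∫⁻ y in P, u y = (∫⁻ y in A, u y) + ∫⁻ y in P \ A, u y := by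
    have := lintegral_inter_add_sdiff (μ := volume) u P hAm
    rw [inter_eq_self_of_subset_right hA] at this
    exact this.symm
  have htop : ∫⁻ y in P, u y ≠ ∞ :=
    ((lintegral_mono_set hP).trans_lt (h.lintegral_ne_top x hr).lt_top).ne
  set κ : ℝ≥0∞ := (C * (2 * K)) ^ (1 / a) with hκ
  -- `κ` is finite, and positive by the next step, so that `κ⁻¹` is a genuine fraction.
  have hκtop : κ ≠ ∞ := by
    have : (0 : ℝ) ≤ 1 / a := (one_div_pos.2 h.pos).le
    exact ENNReal.rpow_ne_top_of_nonneg this (by finiteness)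
  have hκ0 : κ ≠ 0 := by
    intro h0
    rw [h0, zero_mul] at h3
    exact h.lintegral_ne_zero x hr (le_antisymm h3 zero_le)
  have h5 : κ⁻¹ * ∫⁻ y in P, u y ≤ ∫⁻ y in P \ A, u y := by
    rw [ENNReal.inv_mul_le_iff hκ0 hκtop]
    exact (lintegral_mono_set hP).trans h3
  rw [ENNReal.sub_mul fun _ _ => htop, one_mul]
  refine ENNReal.le_sub_of_add_le_right (ENNReal.mul_ne_top (ENNReal.inv_ne_top.2 hκ0) htop) ?_
  rw [h4] at h5 ⊢
  exact add_le_add_right h5 _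

/-- The weighted John–Nirenberg inequality on balls. It follows from `measure_level_le` for the
dyadic cubes of the cube circumscribed about the ball, where the constant attached to a cube is the
mean over its circumscribed ball; no means over cubes are needed. -/
theorem exists_lintegral_bmo_rpow_le (hn : 1 ≤ n) (h : IsDualPair u s a b C) {q : ℝ}
    (hq : 0 < q) :
    ∃ K : ℝ≥0, ∀ f : Rn n → 𝕜, MemBMO f → ∀ (x : Rn n) (r : ℝ), 0 < r →
      ∫⁻ y in ball x r, ‖f y - ballAvg f x r‖ₑ ^ q * u y ≤
        (K * bmoNorm f) ^ q * ∫⁻ y in ball x r, u y := by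
  have hn' : (1 : ℝ) ≤ n := by exact_mod_cast hn
  -- `κ` is the volume of a circumscribed ball relative to its cube.
  set κ : ℝ≥0∞ := ENNReal.ofReal ((2 * n) ^ n) * volume (ball (0 : Rn n) 1) with hκ
  have hκtop : κ ≠ ∞ := ENNReal.mul_ne_top ENNReal.ofReal_ne_top (volume_ball_ne_top _ _)
  have hκ0 : κ ≠ 0 :=
    mul_ne_zero (ENNReal.ofReal_pos.2 (by positivity)).ne' (volume_ball_ne_zero _ one_pos)
  set β : ℝ≥0∞ := 1 - ((C * (2 * κ.toNNReal) : ℝ≥0∞) ^ (1 / a))⁻¹ with hβdef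
  have hβ : β < 1 := by
    refine ENNReal.sub_lt_self ENNReal.one_ne_top one_ne_zero (ENNReal.inv_ne_zero.2 ?_)
    have : (0 : ℝ) ≤ 1 / a := (one_div_pos.2 h.pos).le
    exact ENNReal.rpow_ne_top_of_nonneg this (by finiteness)
  set S₀ : ℝ≥0∞ := ∑' j : ℕ, ((j : ℝ≥0∞) + 1) ^ q * β ^ j with hS
  have hS_top : S₀ ≠ ∞ := (tsum_rpow_mul_geometric_lt_top hβ).ne
  -- The step `3 N + D` of `measure_level_le`, relative to `bmoNorm f`: the mean oscillation on
  -- cubes is at most `N = κ ‖f‖`, the jump to a child at most `D = 2 ^ n ‖f‖`.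
  set Λ₀ : ℝ := 3 * κ.toReal + 2 ^ n with hΛ
  have hΛpos : 0 < Λ₀ := by positivity
  -- The doubling constant of the weight and the ratio of volumes, for the ball of radius `4 n r`.
  set d : ℝ≥0∞ := (C * ENNReal.ofReal ((4 * n) ^ n)) ^ (1 / a) with hd
  have hdtop : d ≠ ∞ := by
    have : (0 : ℝ) ≤ 1 / a := (one_div_pos.2 h.pos).le
    exact ENNReal.rpow_ne_top_of_nonneg this (by finiteness)
  set e : ℝ≥0∞ := ENNReal.ofReal ((4 * n) ^ n) with he
  set K₁ : ℝ≥0∞ := 2 ^ q * (S₀ * ENNReal.ofReal Λ₀ ^ q * d + e ^ q) with hK₁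
  have hK₁top : K₁ ≠ ∞ := by
    have : e ≠ ∞ := ENNReal.ofReal_ne_top
    finiteness
  have hK₂ : K₁ ^ (1 / q) ≠ ∞ := ENNReal.rpow_ne_top_of_nonneg (one_div_pos.2 hq).le hK₁top
  refine ⟨(K₁ ^ (1 / q)).toNNReal, fun f hf x r hr => ?_⟩
  rw [ENNReal.coe_toNNReal hK₂, ENNReal.mul_rpow_of_nonneg _ _ hq.le, ← ENNReal.rpow_mul,
    one_div_mul_cancel hq.ne', ENNReal.rpow_one]
  -- The level sets below are taken at multiples of `bmoNorm f`. If it vanishes, `f` is constant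
  -- almost everywhere on the ball.
  rcases eq_or_ne (bmoNorm f) 0 with hb | hb
  · have h0 := lintegral_sub_ballAvg_le f x hr
    have hm : AEMeasurable (fun y => ‖f y - ballAvg f x r‖ₑ) (volume.restrict (ball x r)) :=
      (hf.1.aestronglyMeasurable.restrict.sub aestronglyMeasurable_const).enorm
    rw [hb, zero_mul, nonpos_iff_eq_zero, lintegral_eq_zero_iff' hm] at h0
    rw [lintegral_congr_ae (g := fun _ => 0)]
    · simp
    · filter_upwards [h0] with y hy
      simp only [Pi.zero_apply] at hy
      rw [hy, ENNReal.zero_rpow_of_pos hq, zero_mul]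
  obtain ⟨t, ht⟩ : ∃ t : ℝ≥0, (t : ℝ≥0∞) = bmoNorm f := ⟨_, ENNReal.coe_toNNReal hf.2.ne⟩
  have ht0 : 0 < (t : ℝ) := by
    rw [← ht] at hb
    exact_mod_cast pos_iff_ne_zero.2 (by simpa using hb)
  set w : Measure (Rn n) := volume.withDensity u with hw
  have hwac : w ≪ volume := withDensity_absolutelyContinuous _ _
  -- The grid whose cube `0` of generation `0` is centered at `x` and has side `2 r`.
  set o : Rn n := WithLp.toLp 2 fun i => x i - r with ho
  have hL : 0 < 2 * r := by positivity
  have hcenter : gridCenter o (2 * r) 0 0 = x := by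
    ext i; simp [gridCenter, ho]
  set P : Set (Rn n) := gridIndex o (2 * r) 0 ⁻¹' {0} with hP
  have hrad : 2 * (n : ℝ) * (2 * r / 2 ^ 0) = 4 * n * r := by simp; ring
  have hPball : P ⊆ ball x (4 * n * r) := by
    have := gridCube_subset_ball hn o hL 0 0
    rwa [hcenter, hrad] at this
  have hballP : ball x r ⊆ P := by
    intro y hy
    refine (gridIndex_eq_iff o hL 0 0 y).2 fun i => ?_
    have h1 : |y i - x i| < r := by
      rw [mem_ball, dist_eq_norm] at hy
      have h2 := PiLp.norm_apply_le (y - x) i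
      rw [PiLp.sub_apply, Real.norm_eq_abs] at h2
      exact h2.trans_lt hy
    rw [abs_lt] at h1
    simp only [ho, Pi.zero_apply, Int.cast_zero, pow_zero, div_one]
    constructor <;> linarith [h1.1, h1.2]
  set c₀ : 𝕜 := ballAvg f x (4 * n * r) with hc₀
  have hlevel : ∀ j : ℕ, (w.restrict P) {y | j * (Λ₀ * t) < ‖f y - c₀‖} ≤ β ^ j * w P := by
    intro j
    have := measure_level_le (μ := volume) (w := w) (π := gridIndex o (2 * r))
      (f := f) (c := fun k z => ballAvg f (gridCenter o (2 * r) k z) (2 * n * (2 * r / 2 ^ k)))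
      (N := κ.toReal * t) (D := 2 ^ n * t) (β := β)
      (fun k z => measurable_gridIndex o (2 * r) k (measurableSet_singleton z))
      (gridIndex_nested o (2 * r)) hf.1.aestronglyMeasurable
      (hwac.ae_le (ae_tendsto_ballAvg hn hf.1 o hL))
      (mul_pos (ENNReal.toReal_pos hκ0 hκtop) ht0) (by positivity) ?_ ?_ ?_ ?_ j 0 0
    · rw [hcenter, hrad] at this
      have hset : {y | j * (Λ₀ * t) < ‖f y - c₀‖} ∩ P =
          {y | gridIndex o (2 * r) 0 y = 0 ∧
            j * (3 * (κ.toReal * t) + 2 ^ n * t) < ‖f y - c₀‖} := by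
        ext y
        rw [show 3 * (κ.toReal * t) + 2 ^ n * t = Λ₀ * t by rw [hΛ]; ring]
        exact and_comm
      rw [Measure.restrict_apply₀' (measurable_gridIndex o (2 * r) 0
        (measurableSet_singleton 0)).nullMeasurableSet, hset]
      exact this
    · intro k y
      have h1 := enorm_ballAvg_sub_le hf.1 (by positivity) (by positivity)
        (gridBall_subset o hL k y) (K := ENNReal.ofReal (2 ^ n)) (le_of_eq ?_)
      · rw [← ht, ← ofReal_norm, ← ENNReal.ofReal_coe_nnreal,
          ← ENNReal.ofReal_mul (by positivity)] at h1
        exact (ENNReal.ofReal_le_ofReal_iff (by positivity)).1 h1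
      · rw [← volume_ball_mul two_pos (gridCenter o (2 * r) k (gridIndex o (2 * r) k y))]
        congr 2
        rw [pow_succ]; field_simp
    · intro k z
      calc _ ≤ ∫⁻ y in ball (gridCenter o (2 * r) k z) (2 * n * (2 * r / 2 ^ k)),
            ‖f y - ballAvg f (gridCenter o (2 * r) k z) (2 * n * (2 * r / 2 ^ k))‖ₑ :=
            lintegral_mono_set (gridCube_subset_ball hn o hL k z)
        _ ≤ bmoNorm f * volume (ball (gridCenter o (2 * r) k z) (2 * n * (2 * r / 2 ^ k))) :=
            lintegral_sub_ballAvg_le f _ (by positivity)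
        _ = _ := by
            rw [volume_gridBall o hL k z hn, ← hκ, ENNReal.ofReal_mul ENNReal.toReal_nonneg,
              ENNReal.ofReal_toReal hκtop, ENNReal.ofReal_coe_nnreal, ht]
            ring
    · intro k z
      rw [volume_gridCube o hL]; exact ENNReal.ofReal_ne_top
    · intro k z A hA hAm hAP
      have hm := measurable_gridIndex o (2 * r) k (measurableSet_singleton z)
      rw [hw, withDensity_apply _ hAm, withDensity_apply _ hm]
      refine h.lintegral_le_mul_of_two_mul_volume_le (by positivity)
        (gridCube_subset_ball hn o hL k z) (K := κ.toNNReal) ?_ hA hAm hAP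
      rw [volume_gridBall o hL k z hn, ENNReal.coe_toNNReal hκtop]
  have hmain := lintegral_rpow_le_of_level (w := w.restrict P) (g := fun y => ‖f y - c₀‖)
    (Λ := Λ₀ * t) (q := q) ((((hf.1.aestronglyMeasurable.sub
      aestronglyMeasurable_const).norm.aemeasurable).mono_ac hwac).restrict)
    (by positivity) hq hlevel
  have hPm : MeasurableSet P := measurable_gridIndex o (2 * r) 0 (measurableSet_singleton 0)
  have hwP : w P ≤ d * ∫⁻ y in ball x r, u y := by
    rw [hw, withDensity_apply _ hPm]
    exact (lintegral_mono_set hPball).trans (h.lintegral_ball_mul_le (by nlinarith) x hr)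
  have h1 : ∫⁻ y in ball x r, ‖f y - c₀‖ₑ ^ q * u y ≤
      (S₀ * ENNReal.ofReal Λ₀ ^ q * d) * t ^ q * ∫⁻ y in ball x r, u y := by
    calc ∫⁻ y in ball x r, ‖f y - c₀‖ₑ ^ q * u y
        ≤ ∫⁻ y in P, ‖f y - c₀‖ₑ ^ q * u y := lintegral_mono_set hballP
      _ = ∫⁻ y in P, ENNReal.ofReal ‖f y - c₀‖ ^ q ∂w := by
          have hm : AEMeasurable (fun y => ENNReal.ofReal ‖f y - c₀‖ ^ q) volume :=
            (hf.1.aestronglyMeasurable.sub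
              aestronglyMeasurable_const).norm.aemeasurable.ennreal_ofReal.pow_const q
          rw [hw, setLIntegral_withDensity_eq_lintegral_mul₀ h.aemeas hm hPm]
          simp only [ofReal_norm, Pi.mul_apply, mul_comm]
      _ ≤ S₀ * ENNReal.ofReal (Λ₀ * t) ^ q * w P := hmain
      _ ≤ S₀ * ENNReal.ofReal (Λ₀ * t) ^ q * (d * ∫⁻ y in ball x r, u y) := by gcongr
      _ = _ := by
          rw [ENNReal.ofReal_mul hΛpos.le, ENNReal.ofReal_coe_nnreal,
            ENNReal.mul_rpow_of_nonneg _ _ hq.le]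
          ring
  have h2 : ‖c₀ - ballAvg f x r‖ₑ ≤ e * t := by
    rw [← enorm_neg, neg_sub, ht]
    exact enorm_ballAvg_sub_le hf.1 hr (by positivity) (hballP.trans hPball)
      (volume_ball_mul (by positivity) _ _ _).le
  rw [← ht]
  calc ∫⁻ y in ball x r, ‖f y - ballAvg f x r‖ₑ ^ q * u y
      ≤ ∫⁻ y in ball x r, (2 ^ q * (‖f y - c₀‖ₑ ^ q * u y) + 2 ^ q * (e * t) ^ q * u y) := by
        refine lintegral_mono fun y => ?_
        rw [mul_assoc (2 ^ q), ← mul_add, ← add_mul, ← mul_assoc]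
        gcongr
        refine le_trans ?_ (add_rpow_le_two_rpow_mul _ _ hq.le)
        gcongr
        calc ‖f y - ballAvg f x r‖ₑ = ‖(f y - c₀) + (c₀ - ballAvg f x r)‖ₑ := by congr 1; ring
          _ ≤ ‖f y - c₀‖ₑ + ‖c₀ - ballAvg f x r‖ₑ := enorm_add_le _ _
          _ ≤ _ := by gcongr
    _ = 2 ^ q * (∫⁻ y in ball x r, ‖f y - c₀‖ₑ ^ q * u y) +
          2 ^ q * (e * t) ^ q * ∫⁻ y in ball x r, u y := by
        rw [lintegral_add_right' _ (h.aemeas.restrict.const_mul _), lintegral_const_mul' _ _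
          (by finiteness), lintegral_const_mul' _ _ (by have : e ≠ ∞ := ENNReal.ofReal_ne_top
                                                        finiteness)]
    _ ≤ 2 ^ q * ((S₀ * ENNReal.ofReal Λ₀ ^ q * d) * t ^ q * ∫⁻ y in ball x r, u y) +
          2 ^ q * (e * t) ^ q * ∫⁻ y in ball x r, u y := by gcongr
    _ = _ := by
        rw [hK₁, ENNReal.mul_rpow_of_nonneg _ _ hq.le]
        ring

end IsDualPair

/-! ### Muckenhoupt weights as dual pairs -/

theorem IsWeight.aemeasurable {w : Rn n → ℝ} (hw : IsWeight w) :
    AEMeasurable (fun y => ENNReal.ofReal (w y)) :=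
  hw.locInt.aestronglyMeasurable.aemeasurable.ennreal_ofReal

theorem rpow_lintegral_mul_le_of_laverage {u s : Rn n → ℝ≥0∞} {a b : ℝ} (ha : 0 < a) (hb : 0 < b)
    (hab : a + b = 1) {C : ℝ≥0∞} {x : Rn n} {r : ℝ} (hr : 0 < r)
    (h : (⨍⁻ y in ball x r, u y ∂volume) ^ a * (⨍⁻ y in ball x r, s y ∂volume) ^ b ≤ C) :
    (∫⁻ y in ball x r, u y) ^ a * (∫⁻ y in ball x r, s y) ^ b ≤ C * volume (ball x r) := by
  rw [← laverage_mul_volume_ball u x hr, ← laverage_mul_volume_ball s x hr,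
    ENNReal.mul_rpow_of_nonneg _ _ ha.le, ENNReal.mul_rpow_of_nonneg _ _ hb.le]
  calc _ = ((⨍⁻ y in ball x r, u y ∂volume) ^ a * (⨍⁻ y in ball x r, s y ∂volume) ^ b) *
        (volume (ball x r) ^ a * volume (ball x r) ^ b) := by ring
    _ = ((⨍⁻ y in ball x r, u y ∂volume) ^ a * (⨍⁻ y in ball x r, s y ∂volume) ^ b) *
        volume (ball x r) := by
        rw [← ENNReal.rpow_add _ _ (volume_ball_ne_zero x hr) (volume_ball_ne_top x r), hab,
          ENNReal.rpow_one]
    _ ≤ _ := by gcongr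

theorem MemA1.memAq_two {w : Rn n → ℝ} (hw : MemA1 w) : MemAq 2 w := by
  obtain ⟨hw, C, hC⟩ := hw
  refine ⟨hw, C, fun x r hr => ?_⟩
  have h1 := hC x r hr
  set I := essInf (fun y => ENNReal.ofReal (w y)) (volume.restrict (ball x r)) with hI
  have h2 : (⨍⁻ y in ball x r, ENNReal.ofReal (w y) ^ (-(1 / ((2 : ℝ) - 1))) ∂volume) ≤ I⁻¹ := by
    rw [setLAverage_eq]
    refine ENNReal.div_le_of_le_mul ?_
    rw [← setLIntegral_const]
    refine lintegral_mono_ae ?_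
    filter_upwards [ae_essInf_le (f := fun y => ENNReal.ofReal (w y))
      (μ := volume.restrict (ball x r))] with y hy
    norm_num [ENNReal.rpow_neg_one]
    exact hy
  calc _ ≤ (C * I) * (I⁻¹) ^ ((2 : ℝ) - 1) := by
        gcongr
    _ = C * (I * I⁻¹) := by norm_num; ring
    _ ≤ C * 1 := by gcongr; exact ENNReal.mul_inv_le_one I
    _ = C := mul_one _

theorem MemAinfty.exists_memAq {w : Rn n → ℝ} (hw : MemAinfty w) : ∃ q : ℝ, 1 < q ∧ MemAq q w :=
  hw.elim (fun h => ⟨2, one_lt_two, h.memAq_two⟩) id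

theorem MemAq.isDualPair {w : Rn n → ℝ} {q : ℝ} (hq : 1 < q) (hw : MemAq q w) :
    ∃ C, IsDualPair (fun y => ENNReal.ofReal (w y))
      (fun y => ENNReal.ofReal (w y) ^ (-(1 / (q - 1)))) (1 / q) ((q - 1) / q) C := by
  obtain ⟨hw, C, hC⟩ := hw
  have hq0 : 0 < q := by linarith
  have hq1 : 0 < q - 1 := by linarith
  refine ⟨C ^ (1 / q), hw.aemeasurable, hw.aemeasurable.pow_const _, by positivity, by positivity,
    by field_simp; ring, ?_, fun x r hr => ?_⟩
  · filter_upwards [hw.pos] with x hx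
    have h0 : ENNReal.ofReal (w x) ≠ 0 := by simpa using hx
    rw [← ENNReal.rpow_mul, ← ENNReal.rpow_add _ _ h0 ENNReal.ofReal_ne_top]
    rw [show 1 / q + -(1 / (q - 1)) * ((q - 1) / q) = 0 by field_simp; ring, ENNReal.rpow_zero]
  · refine rpow_lintegral_mul_le_of_laverage (by positivity) (by positivity)
      (by field_simp; ring) hr ?_
    have h1 := ENNReal.rpow_le_rpow (hC x r hr) (one_div_pos.2 hq0).le
    rw [ENNReal.mul_rpow_of_nonneg _ _ (one_div_pos.2 hq0).le, ← ENNReal.rpow_mul,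
      mul_one_div] at h1
    rwa [ENNReal.coe_rpow_of_nonneg _ (one_div_pos.2 hq0).le]

/-- Hölder's inequality with `m + 1` factors, for a product of powers of the weights and of their
inverses that is identically one. -/
theorem one_le_laverage_prod_mul {x : Rn n} {r : ℝ} (hr : 0 < r) {w : Fin m → Rn n → ℝ}
    (hw : ∀ i, IsWeight (w i)) {p : ℝ} (hp : 0 < p) {pv q : Fin m → ℝ} (hpv : ∀ i, 0 < pv i)
    (hq : ∀ i, 1 < q i) :
    1 ≤ (⨍⁻ y in ball x r, ∏ i, ENNReal.ofReal (w i y) ^ (p / pv i) ∂volume) ^ (1 / p) *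
      ∏ i, (⨍⁻ y in ball x r, ENNReal.ofReal (w i y) ^ (-(1 / (q i - 1))) ∂volume) ^
        ((q i - 1) / pv i) := by
  have hq' : ∀ i, 0 < q i - 1 := fun i => by linarith [hq i]
  have hterm : ∀ i, 0 < p * ((q i - 1) / pv i) := fun i => by
    have := hq' i; have := hpv i; positivity
  -- The exponents `s` and `θ i` make the powers of each weight cancel and add up to one.
  set s : ℝ := (1 + ∑ i, p * ((q i - 1) / pv i))⁻¹ with hs
  have hsum : 0 < 1 + ∑ i, p * ((q i - 1) / pv i) := by
    have := Finset.sum_nonneg fun i (_ : i ∈ Finset.univ) => (hterm i).le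
    linarith
  have hs0 : 0 < s := inv_pos.2 hsum
  set θ : Fin m → ℝ := fun i => s * (p * ((q i - 1) / pv i)) with hθ
  set μ := (volume (ball x r))⁻¹ • volume.restrict (ball x r) with hμ
  have hμac : μ ≪ volume := by
    exact (Measure.smul_absolutelyContinuous).trans Measure.restrict_le_self.absolutelyContinuous
  have hμ1 : μ univ = 1 := by
    rw [hμ, Measure.smul_apply, Measure.restrict_apply_univ, smul_eq_mul,
      ENNReal.inv_mul_cancel (volume_ball_ne_zero x hr) (volume_ball_ne_top x r)]
  have hm : ∀ i, AEMeasurable (fun y => ENNReal.ofReal (w i y)) μ :=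
    fun i => (hw i).aemeasurable.mono_ac hμac
  have hH := ENNReal.lintegral_mul_prod_norm_pow_le (μ := μ) Finset.univ
    (g := fun y => ∏ i, ENNReal.ofReal (w i y) ^ (p / pv i))
    (f := fun i y => ENNReal.ofReal (w i y) ^ (-(1 / (q i - 1))))
    (Finset.aemeasurable_fun_prod _ fun i _ => (hm i).pow_const _)
    (fun i _ => (hm i).pow_const _) (q := s) (p := θ)
    (by rw [hθ, ← Finset.mul_sum, ← mul_one_add, hs, inv_mul_cancel₀ hsum.ne']) hs0.le
    (fun i _ => (mul_pos hs0 (hterm i)).le)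
  have h1 : (1 : ℝ≥0∞) ≤ (∫⁻ y, ∏ i, ENNReal.ofReal (w i y) ^ (p / pv i) ∂μ) ^ s *
      ∏ i, (∫⁻ y, ENNReal.ofReal (w i y) ^ (-(1 / (q i - 1))) ∂μ) ^ θ i := by
    refine le_trans (le_of_eq ?_) hH
    rw [← hμ1, ← lintegral_one]
    refine lintegral_congr_ae ?_
    filter_upwards [hμac.ae_le (ae_all_iff.2 fun i => (hw i).pos)] with y hy
    rw [← ENNReal.prod_rpow_of_nonneg hs0.le, ← Finset.prod_mul_distrib]
    refine (Finset.prod_eq_one fun i _ => ?_).symm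
    have h0 : ENNReal.ofReal (w i y) ≠ 0 := by simpa using hy i
    rw [← ENNReal.rpow_mul, ← ENNReal.rpow_mul, ← ENNReal.rpow_add _ _ h0 ENNReal.ofReal_ne_top]
    have h2 : p / pv i * s + -(1 / (q i - 1)) * θ i = 0 := by
      have := hq' i; have := hpv i
      simp only [hθ]; field_simp; ring
    rw [h2, ENNReal.rpow_zero]
  have h3 := ENNReal.rpow_le_rpow h1 (one_div_pos.2 (mul_pos hs0 hp)).le
  rw [ENNReal.one_rpow, ENNReal.mul_rpow_of_nonneg _ _ (one_div_pos.2 (mul_pos hs0 hp)).le,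
    ← ENNReal.prod_rpow_of_nonneg (one_div_pos.2 (mul_pos hs0 hp)).le, ← ENNReal.rpow_mul] at h3
  simp only [← ENNReal.rpow_mul] at h3
  have e1 : s * (1 / (s * p)) = 1 / p := by field_simp
  have e2 : ∀ i, θ i * (1 / (s * p)) = (q i - 1) / pv i := fun i => by
    have := hpv i
    simp only [hθ]; field_simp
  simp only [e1, e2] at h3
  simpa only [setLAverage_eq'] using h3

/-- If the vector weight is in `A_P` and its components are in `A_∞`, then each component is in
`A_{p_i}`, with dual weight `ω i ^ (1 - p_i')`. -/
theorem MemAP.isDualPair {pv : Fin m → ℝ} (hpv : ∀ i, 1 < pv i) {p : ℝ} (hp : 0 < p)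
    {w : Fin m → Rn n → ℝ} (hP : MemAP pv p w) (hA : ∀ i, MemAinfty (w i)) :
    ∃ C, ∀ i, IsDualPair (fun y => ENNReal.ofReal (w i y))
      (fun y => ENNReal.ofReal (w i y) ^ (1 - pv i / (pv i - 1))) (1 / pv i)
      (1 / (pv i / (pv i - 1))) C := by
  obtain ⟨hw, C, hC⟩ := hP
  choose q hq hAq using fun i => (hA i).exists_memAq
  choose hw' D hD using hAq
  have hpv0 : ∀ i, 0 < pv i := fun i => by linarith [hpv i]
  have hpv1 : ∀ i, 0 < pv i - 1 := fun i => by linarith [hpv i]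
  have ha : ∀ i, 0 < 1 / pv i := fun i => one_div_pos.2 (hpv0 i)
  have hb : ∀ i, 0 < 1 / (pv i / (pv i - 1)) :=
    fun i => one_div_pos.2 (div_pos (hpv0 i) (hpv1 i))
  have hab : ∀ i, 1 / pv i + 1 / (pv i / (pv i - 1)) = 1 := fun i => by
    have := hpv0 i; have := hpv1 i
    field_simp; ring
  have hone : ∀ i, ∀ᵐ y, 1 ≤ ENNReal.ofReal (w i y) ^ (1 / pv i) *
      (ENNReal.ofReal (w i y) ^ (1 - pv i / (pv i - 1))) ^ (1 / (pv i / (pv i - 1))) := by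
    intro i
    filter_upwards [(hw i).pos] with y hy
    have h0 : ENNReal.ofReal (w i y) ≠ 0 := by simpa using hy
    rw [← ENNReal.rpow_mul, ← ENNReal.rpow_add _ _ h0 ENNReal.ofReal_ne_top]
    have h2 : 1 / pv i + (1 - pv i / (pv i - 1)) * (1 / (pv i / (pv i - 1))) = 0 := by
      have := hpv0 i; have := hpv1 i
      field_simp; ring
    rw [h2, ENNReal.rpow_zero]
  refine ⟨C * ∏ i, D i ^ (1 / pv i), fun i => ⟨(hw i).aemeasurable,
    (hw i).aemeasurable.pow_const _, ha i, hb i, hab i, hone i, fun x r hr => ?_⟩⟩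
  refine rpow_lintegral_mul_le_of_laverage (ha i) (hb i) (hab i) hr ?_
  set A : Fin m → ℝ≥0∞ := fun i => ⨍⁻ y in ball x r, ENNReal.ofReal (w i y) ∂volume with hAdef
  set S : Fin m → ℝ≥0∞ := fun i => ⨍⁻ y in ball x r,
    ENNReal.ofReal (w i y) ^ (1 - pv i / (pv i - 1)) ∂volume with hSdef
  set N := (⨍⁻ y in ball x r, ∏ i, ENNReal.ofReal (w i y) ^ (p / pv i) ∂volume) ^ (1 / p)
  set Q : Fin m → ℝ≥0∞ := fun i =>
    ⨍⁻ y in ball x r, ENNReal.ofReal (w i y) ^ (-(1 / (q i - 1))) ∂volume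
  have hA : ∏ i, A i ^ (1 / pv i) ≤ N * ∏ i, (D i : ℝ≥0∞) ^ (1 / pv i) := by
    calc ∏ i, A i ^ (1 / pv i) ≤ (∏ i, A i ^ (1 / pv i)) * (N * ∏ i, Q i ^ ((q i - 1) / pv i)) :=
          le_mul_of_one_le_right' (one_le_laverage_prod_mul hr hw hp hpv0 hq)
      _ = N * ∏ i, (A i * Q i ^ (q i - 1)) ^ (1 / pv i) := by
          rw [mul_left_comm, ← Finset.prod_mul_distrib]
          congr 1
          refine Finset.prod_congr rfl fun i _ => ?_
          rw [ENNReal.mul_rpow_of_nonneg _ _ (ha i).le, ← ENNReal.rpow_mul, mul_one_div]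
      _ ≤ _ := by
          gcongr with i
          · exact (ha i).le
          · exact hD i x r hr
  have hge : ∀ i, 1 ≤ A i ^ (1 / pv i) * S i ^ (1 / (pv i / (pv i - 1))) := by
    intro i
    set μ := (volume (ball x r))⁻¹ • volume.restrict (ball x r) with hμ
    have hμac : μ ≪ volume :=
      (Measure.smul_absolutelyContinuous).trans Measure.restrict_le_self.absolutelyContinuous
    have hμ1 : μ univ = 1 := by
      rw [hμ, Measure.smul_apply, Measure.restrict_apply_univ, smul_eq_mul,
        ENNReal.inv_mul_cancel (volume_ball_ne_zero x hr) (volume_ball_ne_top x r)]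
    have hm : AEMeasurable (fun y => ENNReal.ofReal (w i y)) μ :=
      (hw i).aemeasurable.mono_ac hμac
    have eA : A i = ∫⁻ y, ENNReal.ofReal (w i y) ∂μ := setLAverage_eq' _ _ _
    have eS : S i = ∫⁻ y, ENNReal.ofReal (w i y) ^ (1 - pv i / (pv i - 1)) ∂μ :=
      setLAverage_eq' _ _ _
    rw [eA, eS]
    refine le_trans ?_ (ENNReal.lintegral_mul_norm_pow_le (μ := μ) hm (hm.pow_const _) (ha i).le
      (hb i).le (hab i))
    rw [← hμ1, ← lintegral_one]
    exact lintegral_mono_ae (hμac.ae_le (hone i))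
  calc A i ^ (1 / pv i) * S i ^ (1 / (pv i / (pv i - 1)))
      ≤ ∏ i, A i ^ (1 / pv i) * S i ^ (1 / (pv i / (pv i - 1))) :=
        Finset.single_le_prod' (f := fun i => A i ^ (1 / pv i) * S i ^ (1 / (pv i / (pv i - 1))))
          (fun j _ => hge j) (Finset.mem_univ i)
    _ = (∏ i, A i ^ (1 / pv i)) * ∏ i, S i ^ (1 / (pv i / (pv i - 1))) :=
        Finset.prod_mul_distrib
    _ ≤ (N * ∏ i, (D i : ℝ≥0∞) ^ (1 / pv i)) * ∏ i, S i ^ (1 / (pv i / (pv i - 1))) := by gcongr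
    _ = (N * ∏ i, S i ^ (1 / (pv i / (pv i - 1)))) * ∏ i, (D i : ℝ≥0∞) ^ (1 / pv i) := by ring
    _ ≤ C * ∏ i, (D i : ℝ≥0∞) ^ (1 / pv i) := by gcongr; exact hC x r hr
    _ = _ := by
        push_cast
        congr 1
        exact Finset.prod_congr rfl fun i _ => (ENNReal.coe_rpow_of_nonneg _ (ha i).le).symm

/-! ### Morrey spaces -/

/-- A quasi-triangle inequality for weighted `L^p` norms, valid for all `0 < p`: the exponent of
the target space may be less than one. -/
theorem rpow_lintegral_add_rpow_mul_le {X : Type*} [MeasurableSpace X] {μ : Measure X}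
    {F G W : X → ℝ≥0∞} (hF : AEMeasurable F μ) (hW : AEMeasurable W μ) {p : ℝ} (hp : 0 < p) :
    (∫⁻ x, (F x + G x) ^ p * W x ∂μ) ^ (1 / p) ≤ 2 * 2 ^ (1 / p) *
      ((∫⁻ x, F x ^ p * W x ∂μ) ^ (1 / p) + (∫⁻ x, G x ^ p * W x ∂μ) ^ (1 / p)) := by
  have hp' : 0 ≤ 1 / p := (one_div_pos.2 hp).le
  calc (∫⁻ x, (F x + G x) ^ p * W x ∂μ) ^ (1 / p)
      ≤ (∫⁻ x, 2 ^ p * (F x ^ p * W x + G x ^ p * W x) ∂μ) ^ (1 / p) := by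
        refine ENNReal.rpow_le_rpow (lintegral_mono fun x => ?_) hp'
        rw [← add_mul, ← mul_assoc]
        gcongr
        exact add_rpow_le_two_rpow_mul _ _ hp.le
    _ = (2 ^ p * ((∫⁻ x, F x ^ p * W x ∂μ) + ∫⁻ x, G x ^ p * W x ∂μ)) ^ (1 / p) := by
        rw [lintegral_const_mul' _ _ (by finiteness),
          lintegral_add_left' (f := fun x => F x ^ p * W x) ((hF.pow_const p).mul hW)]
    _ = 2 * ((∫⁻ x, F x ^ p * W x ∂μ) + ∫⁻ x, G x ^ p * W x ∂μ) ^ (1 / p) := by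
        rw [ENNReal.mul_rpow_of_nonneg _ _ hp', ← ENNReal.rpow_mul, mul_one_div_cancel hp.ne',
          ENNReal.rpow_one]
    _ ≤ 2 * (2 ^ (1 / p) * ((∫⁻ x, F x ^ p * W x ∂μ) ^ (1 / p) +
          (∫⁻ x, G x ^ p * W x ∂μ) ^ (1 / p))) := by
        gcongr
        exact add_rpow_le_two_rpow_mul _ _ hp'
    _ = _ := by rw [mul_assoc]

theorem le_morreyNorm (p : ℝ) (φ : Rn n → ℝ → ℝ) (w : Rn n → ℝ) (f : Rn n → 𝕜) (x : Rn n) {r : ℝ}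
    (hr : 0 < r) : (ENNReal.ofReal (φ x r))⁻¹ * wt w (ball x r) ^ (-(1 / p)) *
      (∫⁻ y in ball x r, ‖f y‖ₑ ^ p * ENNReal.ofReal (w y)) ^ (1 / p) ≤ morreyNorm p φ w f :=
  le_iSup_of_le x (le_iSup_of_le r (le_iSup_of_le hr le_rfl))

theorem morreyNorm_mono {p : ℝ} (hp : 0 < p) (φ : Rn n → ℝ → ℝ) (w : Rn n → ℝ) {f g : Rn n → 𝕜}
    (h : ∀ y, ‖f y‖ₑ ≤ ‖g y‖ₑ) : morreyNorm p φ w f ≤ morreyNorm p φ w g := by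
  have := hp.le
  refine iSup_mono fun x => iSup_mono fun r => iSup_mono fun hr => ?_
  gcongr
  exact h _

theorem morreyNorm_smul_le {p : ℝ} (hp : 0 < p) (φ : Rn n → ℝ → ℝ) (w : Rn n → ℝ) (c : 𝕜)
    (f : Rn n → 𝕜) : morreyNorm p φ w (c • f) ≤ ‖c‖ₑ * morreyNorm p φ w f := by
  refine iSup_le fun x => iSup_le fun r => iSup_le fun hr => ?_
  refine le_trans (le_of_eq ?_) (mul_le_mul_right (le_morreyNorm p φ w f x hr) ‖c‖ₑ)
  have h1 : ∫⁻ y in ball x r, ‖(c • f) y‖ₑ ^ p * ENNReal.ofReal (w y) =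
      ‖c‖ₑ ^ p * ∫⁻ y in ball x r, ‖f y‖ₑ ^ p * ENNReal.ofReal (w y) := by
    rw [← lintegral_const_mul' _ _ (by finiteness)]
    refine lintegral_congr fun y => ?_
    rw [Pi.smul_apply, enorm_smul, ENNReal.mul_rpow_of_nonneg _ _ hp.le, mul_assoc]
  rw [h1, ENNReal.mul_rpow_of_nonneg _ _ (one_div_pos.2 hp).le, ← ENNReal.rpow_mul,
    mul_one_div_cancel hp.ne', ENNReal.rpow_one]
  ring

theorem morreyNorm_add_le {p : ℝ} (hp : 0 < p) (φ : Rn n → ℝ → ℝ) {w : Rn n → ℝ}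
    (hw : IsWeight w) {f : Rn n → 𝕜} (hf : AEStronglyMeasurable f volume) (g : Rn n → 𝕜) :
    morreyNorm p φ w (f + g) ≤
      2 * 2 ^ (1 / p) * (morreyNorm p φ w f + morreyNorm p φ w g) := by
  refine iSup_le fun x => iSup_le fun r => iSup_le fun hr => ?_
  have h1 : (∫⁻ y in ball x r, ‖(f + g) y‖ₑ ^ p * ENNReal.ofReal (w y)) ^ (1 / p) ≤
      2 * 2 ^ (1 / p) * ((∫⁻ y in ball x r, ‖f y‖ₑ ^ p * ENNReal.ofReal (w y)) ^ (1 / p) +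
        (∫⁻ y in ball x r, ‖g y‖ₑ ^ p * ENNReal.ofReal (w y)) ^ (1 / p)) := by
    refine le_trans ?_ (rpow_lintegral_add_rpow_mul_le (μ := volume.restrict (ball x r))
      (G := fun y => ‖g y‖ₑ) hf.enorm.restrict hw.aemeasurable.restrict hp)
    gcongr with y
    exact enorm_add_le _ _
  calc _ ≤ (ENNReal.ofReal (φ x r))⁻¹ * wt w (ball x r) ^ (-(1 / p)) * (2 * 2 ^ (1 / p) *
        ((∫⁻ y in ball x r, ‖f y‖ₑ ^ p * ENNReal.ofReal (w y)) ^ (1 / p) +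
        (∫⁻ y in ball x r, ‖g y‖ₑ ^ p * ENNReal.ofReal (w y)) ^ (1 / p))) := by gcongr
    _ = 2 * 2 ^ (1 / p) *
        ((ENNReal.ofReal (φ x r))⁻¹ * wt w (ball x r) ^ (-(1 / p)) *
          (∫⁻ y in ball x r, ‖f y‖ₑ ^ p * ENNReal.ofReal (w y)) ^ (1 / p) +
        (ENNReal.ofReal (φ x r))⁻¹ * wt w (ball x r) ^ (-(1 / p)) *
          (∫⁻ y in ball x r, ‖g y‖ₑ ^ p * ENNReal.ofReal (w y)) ^ (1 / p)) := by ring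
    _ ≤ _ := by
        gcongr
        · exact le_morreyNorm p φ w f x hr
        · exact le_morreyNorm p φ w g x hr

variable (𝕜) in
/-- The Morrey space `M^{p,φ}(w)` as a linear subspace. -/
noncomputable def morreySubmodule {p : ℝ} (hp : 0 < p) (φ : Rn n → ℝ → ℝ) {w : Rn n → ℝ}
    (hw : IsWeight w) : Submodule 𝕜 (Rn n → 𝕜) where
  carrier := morrey 𝕜 p φ w
  zero_mem' := by
    refine ⟨aestronglyMeasurable_zero, ?_⟩
    have := morreyNorm_smul_le hp φ w (0 : 𝕜) 0
    rw [enorm_zero, zero_mul, smul_zero] at this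
    exact this.trans_lt ENNReal.zero_lt_top
  add_mem' := by
    rintro f g ⟨hf, hf'⟩ ⟨hg, hg'⟩
    refine ⟨hf.add hg, (morreyNorm_add_le hp φ hw hf g).trans_lt ?_⟩
    have : (2 : ℝ≥0∞) ^ (1 / p) ≠ ∞ :=
      ENNReal.rpow_ne_top_of_nonneg (one_div_pos.2 hp).le (by finiteness)
    finiteness
  smul_mem' := by
    rintro c f ⟨hf, hf'⟩
    exact ⟨hf.const_smul c, (morreyNorm_smul_le hp φ w c f).trans_lt (by finiteness)⟩

theorem indicator_mem_morrey {p : ℝ} (hp : 0 < p) {φ : Rn n → ℝ → ℝ} {w : Rn n → ℝ}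
    {f : Rn n → 𝕜} (hf : f ∈ morrey 𝕜 p φ w) {A : Set (Rn n)} (hA : MeasurableSet A) :
    A.indicator f ∈ morrey 𝕜 p φ w :=
  ⟨hf.1.indicator hA, (morreyNorm_mono hp φ w fun y => by
    by_cases hy : y ∈ A <;> simp [hy]).trans_lt hf.2⟩

/-! ### Expansion of sublinear expressions -/

/-- Expansion of a functional that is subadditive in each slot over the slots in `t`; the slots off
`t` keep the value `h`. This is the sublinear version of `MultilinearMap.map_piecewise_add`. -/
theorem map_piecewise_add_le_sum {ι M : Type*} [DecidableEq ι] [AddCommGroup M]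
    [Module 𝕜 M] {V : ι → Submodule 𝕜 M} {Φ : (ι → M) → ℝ≥0∞}
    (hΦ : ∀ f : ι → M, (∀ i, f i ∈ V i) → ∀ i, ∀ g ∈ V i,
      Φ (Function.update f i (f i + g)) ≤ Φ f + Φ (Function.update f i g))
    (t : Finset ι) {g : ι → M} (hg : ∀ i, g i ∈ V i) :
    ∀ {h : ι → M}, (∀ i, h i ∈ V i) →
      Φ (t.piecewise (g + h) h) ≤ ∑ s ∈ t.powerset, Φ (s.piecewise g h) := by
  induction t using Finset.induction_on with
  | empty => intro h _; simp
  | insert a t ha ih =>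
    intro h hh
    -- The term with `g a` in slot `a` is an instance of the induction hypothesis with base point
    -- `h'` in place of `h`.
    set h' : ι → M := Function.update h a (g a) with hh'
    have hh'V : ∀ i, h' i ∈ V i := by
      intro i
      rcases eq_or_ne i a with rfl | hi
      · simpa [hh'] using hg i
      · simpa [hh', hi] using hh i
    have e1 : Function.update (t.piecewise (g + h) h) a (g a) = t.piecewise (g + h') h' := by
      ext i
      rcases eq_or_ne i a with rfl | hi
      · simp [ha, hh']
      · by_cases hit : i ∈ t <;> simp [hi, hit, hh']
    have hV : ∀ i, t.piecewise (g + h') h' i ∈ V i := by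
      intro i
      by_cases hit : i ∈ t
      · simpa [hit] using (V i).add_mem (hg i) (hh'V i)
      · simpa [hit] using hh'V i
    have e2 : (insert a t).piecewise (g + h) h =
        Function.update (t.piecewise (g + h') h') a (t.piecewise (g + h') h' a + h a) := by
      rw [Finset.piecewise_insert, ← e1]
      simp
    have e3 : Function.update (t.piecewise (g + h') h') a (h a) = t.piecewise (g + h) h := by
      rw [← e1, Function.update_idem]
      refine Function.update_eq_self_iff.2 ?_
      simp [ha]
    rw [e2, Finset.sum_powerset_insert ha]
    calc _ ≤ Φ (t.piecewise (g + h') h') + Φ (t.piecewise (g + h) h) := by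
          rw [← e3]; exact hΦ _ hV a _ (hh a)
      _ ≤ ∑ s ∈ t.powerset, Φ (s.piecewise g h') + ∑ s ∈ t.powerset, Φ (s.piecewise g h) :=
          add_le_add (ih hh'V) (ih hh)
      _ = ∑ s ∈ t.powerset, Φ (s.piecewise g h) +
            ∑ s ∈ t.powerset, Φ ((insert a s).piecewise g h) := by
          rw [add_comm]
          congr 1
          refine Finset.sum_congr rfl fun s hs => ?_
          congr 1
          have has : a ∉ s := fun h => ha (Finset.mem_powerset.1 hs h)
          ext i
          rcases eq_or_ne i a with rfl | hi
          · simp [has, hh']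
          · by_cases his : i ∈ s <;> simp [hi, his, hh']

theorem map_add_le_sum {ι M : Type*} [Fintype ι] [DecidableEq ι] [AddCommGroup M]
    [Module 𝕜 M] {V : ι → Submodule 𝕜 M} {Φ : (ι → M) → ℝ≥0∞}
    (hΦ : ∀ f : ι → M, (∀ i, f i ∈ V i) → ∀ i, ∀ g ∈ V i,
      Φ (Function.update f i (f i + g)) ≤ Φ f + Φ (Function.update f i g))
    {g h : ι → M} (hg : ∀ i, g i ∈ V i) (hh : ∀ i, h i ∈ V i) :
    Φ (g + h) ≤ ∑ s : Finset ι, Φ (s.piecewise g h) := by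
  simpa using map_piecewise_add_le_sum hΦ Finset.univ hg hh

theorem map_smul_eq_prod {ι M : Type*} [Fintype ι] [DecidableEq ι] [AddCommGroup M]
    [Module 𝕜 M] {V : ι → Submodule 𝕜 M} {Φ : (ι → M) → ℝ≥0∞}
    (hΦ : ∀ f : ι → M, (∀ i, f i ∈ V i) → ∀ i, ∀ c : 𝕜,
      Φ (Function.update f i (c • f i)) = ‖c‖ₑ * Φ f)
    {g : ι → M} (hg : ∀ i, g i ∈ V i) (c : ι → 𝕜) :
    Φ (fun i => c i • g i) = (∏ i, ‖c i‖ₑ) * Φ g := by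
  have key : ∀ t : Finset ι,
      Φ (t.piecewise (fun i => c i • g i) g) = (∏ i ∈ t, ‖c i‖ₑ) * Φ g := by
    intro t
    induction t using Finset.induction_on with
    | empty => simp
    | insert a t ha ih =>
      have e1 : (insert a t).piecewise (fun i => c i • g i) g =
          Function.update (t.piecewise (fun i => c i • g i) g) a
            (c a • t.piecewise (fun i => c i • g i) g a) := by
        rw [Finset.piecewise_insert]; simp [ha]
      have hV : ∀ i, t.piecewise (fun i => c i • g i) g i ∈ V i := by
        intro i
        by_cases hit : i ∈ t
        · simpa [hit] using (V i).smul_mem _ (hg i)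
        · simpa [hit] using hg i
      rw [e1, hΦ _ hV, ih, Finset.prod_insert ha, mul_assoc]
  simpa using key Finset.univ

/-! ### Pointwise expansion of the iterated commutator -/

theorem splitAt_coe [DecidableEq (Fin m)] (S : Finset (Fin m)) (x : Rn n) (r : ℝ)
    (f : Fin m → Rn n → 𝕜) : splitAt (S : Set (Fin m)) x r f = S.piecewise
      (fun i => (ball x (2 * r))ᶜ.indicator (f i)) fun i => (ball x (2 * r)).indicator (f i) := by
  ext i y
  by_cases hi : i ∈ S <;> simp [splitAt, hi]

theorem splitAt_mul (S : Set (Fin m)) (x : Rn n) (r : ℝ) (c f : Fin m → Rn n → 𝕜) (i : Fin m)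
    (y : Rn n) : splitAt S x r (fun i y => c i y * f i y) i y = c i y * splitAt S x r f i y := by
  by_cases hi : i ∈ S <;> by_cases hy : y ∈ ball x (2 * r) <;> simp [splitAt, hi, hy]

/-- A finite-dimensional subspace of `X + bX` that contains `U` and `(c - b) U` for every scalar
`c`. The exceptional null set of a sublinear operator can thus be chosen once for all the functions
`(b (y) - b) f`, although they depend on the point `y` of evaluation. -/
theorem exists_finiteDimensional_le_commDomain {X : Submodule 𝕜 (Rn n → 𝕜)} (b : Rn n → 𝕜)
    {U : Submodule 𝕜 (Rn n → 𝕜)} [FiniteDimensional 𝕜 U] (hU : U ≤ X) :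
    ∃ V : Submodule 𝕜 (Rn n → 𝕜), FiniteDimensional 𝕜 V ∧
      (V : Set (Rn n → 𝕜)) ⊆ commDomain X b ∧ U ≤ V ∧
      ∀ g ∈ U, ∀ c : 𝕜, (fun z => (c - b z) * g z) ∈ V := by
  refine ⟨U ⊔ U.map (LinearMap.mulLeft 𝕜 b), inferInstance, ?_, le_sup_left, ?_⟩
  · intro f hf
    obtain ⟨g, hg, k, hk, rfl⟩ := Submodule.mem_sup.1 hf
    obtain ⟨h, hh, rfl⟩ := Submodule.mem_map.1 hk
    exact ⟨g, hU hg, h, hU hh, rfl⟩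
  · intro g hg c
    refine Submodule.mem_sup.2 ⟨c • g, U.smul_mem c hg, LinearMap.mulLeft 𝕜 b (-g),
      Submodule.mem_map_of_mem (U.neg_mem hg), ?_⟩
    ext z
    simp only [Pi.add_apply, Pi.smul_apply, LinearMap.mulLeft_apply, Pi.mul_apply, Pi.neg_apply,
      smul_eq_mul]
    ring

/-- The pointwise estimate on a ball. In the term of index `s`, the slots in `s` carry the factor
`b i (y) - c i` outside of `T` and the other slots carry `c i - b i` inside. -/
theorem ae_enorm_iterComm_le {X : Fin m → Submodule 𝕜 (Rn n → 𝕜)}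
    (hX : ∀ i, ∀ f ∈ X i, ∀ A : Set (Rn n), MeasurableSet A → A.indicator f ∈ X i)
    {T : (Fin m → Rn n → 𝕜) → Rn n → 𝕜} {b : Fin m → Rn n → 𝕜} {A : ℝ≥0}
    (hT : LSWith A (fun i => commDomain (X i : Set (Rn n → 𝕜)) (b i)) T) (x : Rn n)
    {r : ℝ} (hr : 0 < r) (c : Fin m → 𝕜) {f : Fin m → Rn n → 𝕜} (hf : ∀ i, f i ∈ X i) :
    ∀ᵐ y ∂volume.restrict (ball x r), ‖iterComm b T f y‖ₑ ≤
      ‖iterComm b T (splitAt ∅ x r f) y‖ₑ +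
        2 ^ m * ∑ s : Finset (Fin m), (∏ i ∈ s, ‖b i y - c i‖ₑ) *
          (A * ∑' j : ℕ, ∏ i, ⨍⁻ z in ball x (2 ^ (j + 2) * r),
            ‖(if i ∈ s then 1 else c i - b i z) * f i z‖ₑ ∂volume) := by
  classical
  set hi : Fin m → Rn n → 𝕜 := fun i => (ball x (2 * r))ᶜ.indicator (f i) with hhi
  set lo : Fin m → Rn n → 𝕜 := fun i => (ball x (2 * r)).indicator (f i) with hlo
  set U : Fin m → Submodule 𝕜 (Rn n → 𝕜) := fun i => Submodule.span 𝕜 {hi i, lo i} with hU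
  have hUX : ∀ i, U i ≤ X i := by
    intro i
    refine Submodule.span_le.2 ?_
    rintro g (rfl | rfl)
    · exact hX i _ (hf i) _ measurableSet_ball.compl
    · exact hX i _ (hf i) _ measurableSet_ball
  have hfin : ∀ i, FiniteDimensional 𝕜 (U i) := fun i =>
    FiniteDimensional.span_of_finite 𝕜 (by simp)
  have hhiU : ∀ i, hi i ∈ U i := fun i => Submodule.subset_span (by simp)
  have hloU : ∀ i, lo i ∈ U i := fun i => Submodule.subset_span (by simp)
  choose V hVfin hVD hUV hVb using fun i => exists_finiteDimensional_le_commDomain (b i) (hUX i)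
  have hsub := hT.1.2 V hVfin hVD
  -- The functions to which the size condition is applied.
  set F : Finset (Fin m) → Fin m → Rn n → 𝕜 :=
    fun s i z => (if i ∈ s then 1 else c i - b i z) * f i z with hF
  have hFD : ∀ s i, F s i ∈ commDomain (X i : Set (Rn n → 𝕜)) (b i) := by
    intro s i
    by_cases his : i ∈ s
    · exact ⟨f i, hf i, 0, (X i).zero_mem, by ext z; simp [hF, his]⟩
    · refine ⟨c i • f i, (X i).smul_mem _ (hf i), -f i, (X i).neg_mem (hf i), ?_⟩
      ext z
      simp only [hF, his, if_false, Pi.smul_apply, Pi.neg_apply, smul_eq_mul]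
      ring
  have hsize : ∀ᵐ y ∂volume.restrict (ball x r), ∀ S : Finset (Fin m), S.Nonempty →
      ∀ s : Finset (Fin m), ‖T (splitAt S x r (F s)) y‖ₑ ≤
        A * ∑' j : ℕ, ∏ i, ⨍⁻ z in ball x (2 ^ (j + 2) * r), ‖F s i z‖ₑ ∂volume := by
    rw [ae_all_iff]; intro S
    rw [eventually_imp_distrib_left]; intro hS
    rw [ae_all_iff]; intro s
    have h1 := hT.2 x r hr (F s) (hFD s) S hS
    rw [eLpNorm_exponent_top] at h1
    filter_upwards [enorm_ae_le_eLpNormEssSup (T (splitAt S x r (F s)))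
      (volume.restrict (ball x r))] with y hy using hy.trans h1
  filter_upwards [ae_restrict_of_ae hsub, hsize] with y hy hysize
  set Φ : (Fin m → Rn n → 𝕜) → ℝ≥0∞ := fun g => ‖T g y‖ₑ with hΦ
  have hΦ1 : ∀ f : Fin m → Rn n → 𝕜, (∀ i, f i ∈ V i) → ∀ i, ∀ g ∈ V i,
      Φ (Function.update f i (f i + g)) ≤ Φ f + Φ (Function.update f i g) := by
    intro f hf i g hg
    have h1 := ((hy f hf i).1 g hg)
    simp only [hΦ, ← ofReal_norm]
    rw [← ENNReal.ofReal_add (norm_nonneg _) (norm_nonneg _)]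
    exact ENNReal.ofReal_le_ofReal h1
  have hΦ2 : ∀ f : Fin m → Rn n → 𝕜, (∀ i, f i ∈ V i) → ∀ i, ∀ c : 𝕜,
      Φ (Function.update f i (c • f i)) = ‖c‖ₑ * Φ f := by
    intro f hf i c
    have h1 := ((hy f hf i).2 c)
    simp only [hΦ, ← ofReal_norm]
    rw [← ENNReal.ofReal_mul (norm_nonneg _), h1]
  have hsplitU : ∀ (S : Finset (Fin m)) i, splitAt S x r f i ∈ U i := by
    intro S i
    rw [splitAt_coe]
    by_cases hiS : i ∈ S
    · simpa [hiS] using hhiU i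
    · simpa [hiS] using hloU i
  have hterm : ∀ S : Finset (Fin m), S.Nonempty →
      Φ (fun i z => (b i y - b i z) * splitAt S x r f i z) ≤
        ∑ s : Finset (Fin m), (∏ i ∈ s, ‖b i y - c i‖ₑ) *
          (A * ∑' j : ℕ, ∏ i, ⨍⁻ z in ball x (2 ^ (j + 2) * r), ‖F s i z‖ₑ ∂volume) := by
    intro S hS
    set u : Fin m → Rn n → 𝕜 := fun i => (b i y - c i) • splitAt S x r f i with hu
    set v : Fin m → Rn n → 𝕜 := fun i z => (c i - b i z) * splitAt S x r f i z with hv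
    have e1 : (fun i z => (b i y - b i z) * splitAt S x r f i z) = u + v := by
      ext i z
      simp only [hu, hv, Pi.add_apply, Pi.smul_apply, smul_eq_mul]
      ring
    rw [e1]
    refine (map_add_le_sum hΦ1 (fun i => (V i).smul_mem _ (hUV i (hsplitU S i)))
      fun i => hVb i _ (hsplitU S i) _).trans (Finset.sum_le_sum fun s _ => ?_)
    have e2 : s.piecewise u v =
        fun i => (if i ∈ s then b i y - c i else 1) • splitAt S x r (F s) i := by
      ext i z
      have e3 : splitAt S x r (F s) i z =
          (if i ∈ s then 1 else c i - b i z) * splitAt S x r f i z :=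
        splitAt_mul (S : Set (Fin m)) x r (fun i z => if i ∈ s then 1 else c i - b i z) f i z
      rw [Pi.smul_apply, e3]
      by_cases his : i ∈ s <;> simp [his, hu, hv]
    have hFV : ∀ i, splitAt S x r (F s) i ∈ V i := by
      intro i
      have e3 : splitAt S x r (F s) i =
          fun z => (if i ∈ s then 1 else c i - b i z) * splitAt S x r f i z := funext fun z =>
        splitAt_mul (S : Set (Fin m)) x r (fun i z => if i ∈ s then 1 else c i - b i z) f i z
      rw [e3]
      by_cases his : i ∈ s
      · simpa [his] using hUV i (hsplitU S i)
      · simpa [his] using hVb i _ (hsplitU S i) (c i)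
    rw [e2, map_smul_eq_prod hΦ2 hFV]
    have e4 : ∏ i, ‖(if i ∈ s then b i y - c i else 1)‖ₑ = ∏ i ∈ s, ‖b i y - c i‖ₑ := by
      rw [← Finset.prod_filter_mul_prod_filter_not Finset.univ (· ∈ s)]
      rw [Finset.filter_mem_eq_inter, Finset.univ_inter]
      rw [Finset.prod_congr rfl (g := fun i => ‖b i y - c i‖ₑ) fun i hi => by simp [hi]]
      rw [Finset.prod_eq_one (s := Finset.univ.filter (· ∉ s)) fun i hi => by
        rw [if_neg (Finset.mem_filter.1 hi).2]; simp, mul_one]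
    rw [e4]
    gcongr
    exact hysize S hS s
  have e0 : iterComm b T f y = T ((fun i z => (b i y - b i z) * hi i z) +
      fun i z => (b i y - b i z) * lo i z) y := by
    simp only [iterComm]
    congr 1
    ext i z
    by_cases hz : z ∈ ball x (2 * r) <;> simp [hhi, hlo, hz]
  have hpw : ∀ S : Finset (Fin m), S.piecewise (fun i z => (b i y - b i z) * hi i z)
      (fun i z => (b i y - b i z) * lo i z) =
        fun i z => (b i y - b i z) * splitAt S x r f i z := by
    intro S
    ext i z
    rw [splitAt_coe]
    by_cases hiS : i ∈ S <;> simp [hiS, hhi, hlo]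
  rw [e0]
  refine (map_add_le_sum hΦ1 (fun i => hVb i _ (hhiU i) _) fun i => hVb i _ (hloU i) _).trans ?_
  rw [← Finset.add_sum_erase _ _ (Finset.mem_univ (∅ : Finset (Fin m)))]
  refine add_le_add ?_ ?_
  · rw [hpw, Finset.coe_empty]
    exact le_rfl
  · refine (Finset.sum_le_card_nsmul _ _ (∑ s : Finset (Fin m), (∏ i ∈ s, ‖b i y - c i‖ₑ) *
      (A * ∑' j : ℕ, ∏ i, ⨍⁻ z in ball x (2 ^ (j + 2) * r), ‖F s i z‖ₑ ∂volume))
      fun S hS => ?_).trans ?_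
    · rw [hpw]
      exact hterm S (Finset.nonempty_iff_ne_empty.2 (Finset.ne_of_mem_erase hS))
    · rw [nsmul_eq_mul]
      gcongr
      have h1 := Finset.card_erase_le (s := (Finset.univ : Finset (Finset (Fin m)))) (a := ∅)
      rw [Finset.card_univ, Fintype.card_finset, Fintype.card_fin] at h1
      exact_mod_cast h1

/-! ### Oscillation on dilated balls -/

theorem ballAvg_two_pow_sub_le {f : Rn n → 𝕜} (hf : LocallyIntegrable f volume) (x : Rn n) {r : ℝ}
    (hr : 0 < r) (k : ℕ) :
    ‖ballAvg f x (2 ^ k * r) - ballAvg f x r‖ₑ ≤ k * 2 ^ n * bmoNorm f := by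
  induction k with
  | zero => simp
  | succ k ih =>
    have e1 : (2 : ℝ) ^ (k + 1) * r = 2 * (2 ^ k * r) := by ring
    have h1 : ‖ballAvg f x (2 ^ k * r) - ballAvg f x (2 ^ (k + 1) * r)‖ₑ ≤ 2 ^ n * bmoNorm f := by
      refine enorm_ballAvg_sub_le hf (by positivity) (by positivity)
        (ball_subset_ball ?_) ?_
      · rw [e1]; nlinarith [pow_pos (zero_lt_two' ℝ) k, mul_pos (pow_pos (zero_lt_two' ℝ) k) hr]
      · rw [e1, volume_ball_mul two_pos x x, ENNReal.ofReal_pow zero_le_two, ENNReal.ofReal_ofNat]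
    calc _ = ‖(ballAvg f x (2 ^ k * r) - ballAvg f x r) -
          (ballAvg f x (2 ^ k * r) - ballAvg f x (2 ^ (k + 1) * r))‖ₑ := by congr 1; ring
      _ ≤ k * 2 ^ n * bmoNorm f + 2 ^ n * bmoNorm f := enorm_sub_le.trans (add_le_add ih h1)
      _ = _ := by push_cast; ring

namespace IsDualPair

variable {u s : Rn n → ℝ≥0∞} {a b : ℝ} {C : ℝ≥0}

/-- The weighted John–Nirenberg inequality with an added constant `d`, which absorbs a change of the
constant subtracted from `f`. -/
theorem exists_rpow_lintegral_bmo_add_le (hn : 1 ≤ n) (h : IsDualPair u s a b C) {q : ℝ}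
    (hq : 0 < q) :
    ∃ K : ℝ≥0, ∀ f : Rn n → 𝕜, MemBMO f → ∀ (x : Rn n) (r : ℝ), 0 < r → ∀ d : ℝ≥0∞,
      (∫⁻ y in ball x r, (‖f y - ballAvg f x r‖ₑ + d) ^ q * u y) ^ (1 / q) ≤
        K * (bmoNorm f + d) * (∫⁻ y in ball x r, u y) ^ (1 / q) := by
  obtain ⟨K, hK⟩ := h.exists_lintegral_bmo_rpow_le (𝕜 := 𝕜) hn hq
  have hq' : 0 ≤ 1 / q := (one_div_pos.2 hq).le
  have htop : (2 : ℝ≥0∞) * 2 ^ (1 / q) * (K + 1) ≠ ∞ := by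
    have : (2 : ℝ≥0∞) ^ (1 / q) ≠ ∞ := ENNReal.rpow_ne_top_of_nonneg hq' (by finiteness)
    finiteness
  refine ⟨(2 * 2 ^ (1 / q) * (K + 1) : ℝ≥0∞).toNNReal, fun f hf x r hr d => ?_⟩
  rw [ENNReal.coe_toNNReal htop]
  have hm : AEMeasurable (fun y => ‖f y - ballAvg f x r‖ₑ) (volume.restrict (ball x r)) :=
    (hf.1.aestronglyMeasurable.restrict.sub aestronglyMeasurable_const).enorm
  have h1 : (∫⁻ y in ball x r, ‖f y - ballAvg f x r‖ₑ ^ q * u y) ^ (1 / q) ≤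
      K * bmoNorm f * (∫⁻ y in ball x r, u y) ^ (1 / q) := by
    refine (ENNReal.rpow_le_rpow (hK f hf x r hr) hq').trans (le_of_eq ?_)
    rw [ENNReal.mul_rpow_of_nonneg _ _ hq', ← ENNReal.rpow_mul, mul_one_div_cancel hq.ne',
      ENNReal.rpow_one]
  have h2 : (∫⁻ y in ball x r, d ^ q * u y) ^ (1 / q) =
      d * (∫⁻ y in ball x r, u y) ^ (1 / q) := by
    rw [lintegral_const_mul'' _ h.aemeas.restrict, ENNReal.mul_rpow_of_nonneg _ _ hq',
      ← ENNReal.rpow_mul, mul_one_div_cancel hq.ne', ENNReal.rpow_one]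
  calc _ ≤ 2 * 2 ^ (1 / q) *
        ((∫⁻ y in ball x r, ‖f y - ballAvg f x r‖ₑ ^ q * u y) ^ (1 / q) +
          (∫⁻ y in ball x r, d ^ q * u y) ^ (1 / q)) :=
        rpow_lintegral_add_rpow_mul_le (G := fun _ => d) hm h.aemeas.restrict hq
    _ ≤ 2 * 2 ^ (1 / q) * (K * bmoNorm f * (∫⁻ y in ball x r, u y) ^ (1 / q) +
          d * (∫⁻ y in ball x r, u y) ^ (1 / q)) := by rw [h2]; gcongr
    _ = 2 * 2 ^ (1 / q) * (K * bmoNorm f + d) * (∫⁻ y in ball x r, u y) ^ (1 / q) := by ring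
    _ ≤ 2 * 2 ^ (1 / q) * ((K + 1) * (bmoNorm f + d)) * (∫⁻ y in ball x r, u y) ^ (1 / q) := by
        gcongr
        calc K * bmoNorm f + d ≤ K * bmoNorm f + d + (bmoNorm f + K * d) := le_self_add
          _ = _ := by ring
    _ = _ := by ring

/-- Hölder's inequality for `g F` with respect to a pair of dual weights, `F` being measured against
`u` and `g` against `s`. -/
theorem laverage_mul_le (h : IsDualPair u s a b C) {x : Rn n} {r : ℝ} (hr : 0 < r)
    {g F : Rn n → ℝ≥0∞} (hg : AEMeasurable g) (hF : AEMeasurable F) {D : ℝ≥0∞}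
    (hD : (∫⁻ y in ball x r, g y ^ (1 / b) * s y) ^ b ≤ D * (∫⁻ y in ball x r, s y) ^ b) :
    (⨍⁻ y in ball x r, g y * F y ∂volume) ≤
      D * C * ((∫⁻ y in ball x r, F y ^ (1 / a) * u y) ^ a / (∫⁻ y in ball x r, u y) ^ a) := by
  have hu0 : (∫⁻ y in ball x r, u y) ^ a ≠ 0 := by
    simp [ENNReal.rpow_eq_zero_iff, h.lintegral_ne_zero x hr, h.pos.not_gt]
  have hutop : (∫⁻ y in ball x r, u y) ^ a ≠ ∞ :=
    ENNReal.rpow_ne_top_of_nonneg h.pos.le (h.lintegral_ne_top x hr)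
  set L := (∫⁻ y in ball x r, F y ^ (1 / a) * u y) ^ a with hL
  have h1 : ∫⁻ y in ball x r, g y * F y ≤ L * (∫⁻ y in ball x r, g y ^ (1 / b) * s y) ^ b := by
    refine le_trans ?_ (ENNReal.lintegral_mul_norm_pow_le
      ((hF.pow_const (1 / a)).mul h.aemeas).restrict
      ((hg.pow_const (1 / b)).mul h.aemeas').restrict h.pos.le h.pos'.le h.add_eq)
    refine lintegral_mono_ae ?_
    filter_upwards [ae_restrict_of_ae h.one_le] with y hy
    simp only [Pi.mul_apply]
    rw [ENNReal.mul_rpow_of_nonneg _ _ h.pos.le, ENNReal.mul_rpow_of_nonneg _ _ h.pos'.le,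
      ← ENNReal.rpow_mul, ← ENNReal.rpow_mul, one_div_mul_cancel h.pos.ne',
      one_div_mul_cancel h.pos'.ne', ENNReal.rpow_one, ENNReal.rpow_one]
    calc g y * F y ≤ g y * F y * (u y ^ a * s y ^ b) := le_mul_of_one_le_right' hy
      _ = _ := by ring
  rw [setLAverage_eq, ← mul_div_assoc, ENNReal.le_div_iff_mul_le (Or.inl hu0) (Or.inl hutop),
    div_eq_mul_inv, mul_right_comm, ← div_eq_mul_inv]
  refine ENNReal.div_le_of_le_mul ?_
  calc (∫⁻ y in ball x r, g y * F y) * (∫⁻ y in ball x r, u y) ^ a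
      ≤ (L * (D * (∫⁻ y in ball x r, s y) ^ b)) * (∫⁻ y in ball x r, u y) ^ a := by
        gcongr; exact h1.trans (by gcongr)
    _ = D * L * ((∫⁻ y in ball x r, u y) ^ a * (∫⁻ y in ball x r, s y) ^ b) := by ring
    _ ≤ D * L * (C * volume (ball x r)) := mul_le_mul_right (h.le x r hr) _
    _ = _ := by ring

/-- The estimate of one slot: the average over a dilate of `B` of `|F|` (if `P`) or of
`|f_B - f| |F|` (otherwise). The factor `k + 1` comes from the distance between the means
of `f` over `B` and over `2 ^ k B`. -/
theorem exists_laverage_mul_le (hn : 1 ≤ n) (h : IsDualPair u s a b C) :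
    ∃ K : ℝ≥0, ∀ f : Rn n → 𝕜, MemBMO f → ∀ F : Rn n → 𝕜, AEStronglyMeasurable F volume →
      ∀ (x : Rn n) (r : ℝ), 0 < r → ∀ (k : ℕ) (P : Prop) [Decidable P],
      (⨍⁻ y in ball x (2 ^ k * r), ‖(if P then 1 else ballAvg f x r - f y) * F y‖ₑ ∂volume) ≤
        K * (if P then 1 else bmoNorm f) * ((k + 1) *
          ((∫⁻ y in ball x (2 ^ k * r), ‖F y‖ₑ ^ (1 / a) * u y) ^ a /
            (∫⁻ y in ball x (2 ^ k * r), u y) ^ a)) := by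
  obtain ⟨K, hK⟩ := h.symm.exists_rpow_lintegral_bmo_add_le (𝕜 := 𝕜) hn (one_div_pos.2 h.pos')
  refine ⟨(1 + K * 2 ^ n) * C, fun f hf F hF x r hr k P _ => ?_⟩
  simp only [enorm_mul]
  have hR : 0 < 2 ^ k * r := by positivity
  set c : ℝ≥0∞ := if P then 1 else bmoNorm f with hc
  have hD : (∫⁻ y in ball x (2 ^ k * r),
      ‖if P then 1 else ballAvg f x r - f y‖ₑ ^ (1 / b) * s y) ^ b ≤
        ((1 + K * 2 ^ n) * c * (k + 1)) * (∫⁻ y in ball x (2 ^ k * r), s y) ^ b := by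
    by_cases hP : P
    · simp only [hP, if_true, enorm_one, ENNReal.one_rpow, one_mul, hc, mul_one]
      refine le_mul_of_one_le_left' ?_
      calc (1 : ℝ≥0∞) = 1 * 1 := (mul_one _).symm
        _ ≤ _ := mul_le_mul' le_self_add le_add_self
    · simp only [hP, if_false, hc]
      have h1 := hK f hf x (2 ^ k * r) hR (k * 2 ^ n * bmoNorm f)
      rw [one_div_one_div] at h1
      have hb := h.pos'.le
      have hb' := (one_div_pos.2 h.pos').le
      calc (∫⁻ y in ball x (2 ^ k * r), ‖ballAvg f x r - f y‖ₑ ^ (1 / b) * s y) ^ b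
          ≤ (∫⁻ y in ball x (2 ^ k * r), (‖f y - ballAvg f x (2 ^ k * r)‖ₑ +
              k * 2 ^ n * bmoNorm f) ^ (1 / b) * s y) ^ b := by
            gcongr with y
            calc ‖ballAvg f x r - f y‖ₑ = ‖(f y - ballAvg f x (2 ^ k * r)) +
                  (ballAvg f x (2 ^ k * r) - ballAvg f x r)‖ₑ := by
                  rw [← enorm_neg]; congr 1; ring
              _ ≤ _ := (enorm_add_le _ _).trans
                  (add_le_add_right (ballAvg_two_pow_sub_le hf.1 x hr k) _)
        _ ≤ _ := h1
        _ ≤ _ := by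
            refine mul_le_mul_left ?_ _
            calc (K : ℝ≥0∞) * (bmoNorm f + k * 2 ^ n * bmoNorm f)
                = K * (1 + k * 2 ^ n) * bmoNorm f := by ring
              _ ≤ K * (2 ^ n + k * 2 ^ n) * bmoNorm f := by
                  gcongr
                  exact one_le_pow₀ one_le_two
              _ = (K * 2 ^ n) * bmoNorm f * (k + 1) := by ring
              _ ≤ _ := by gcongr; exact le_add_self
  have hg : AEMeasurable fun y => ‖if P then 1 else ballAvg f x r - f y‖ₑ := by
    by_cases hP : P
    · simp [hP]
    · simpa [hP] using (aestronglyMeasurable_const.sub hf.1.aestronglyMeasurable).enorm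
  refine (h.laverage_mul_le hR hg hF.enorm hD).trans (le_of_eq ?_)
  push_cast
  ring

theorem exists_rpow_lintegral_prod_bmo_le (hn : 1 ≤ n) (hm : 1 ≤ m) (h : IsDualPair u s a b C)
    {p : ℝ} (hp : 0 < p) :
    ∃ K : ℝ≥0, ∀ f : Fin m → Rn n → 𝕜, (∀ i, MemBMO (f i)) → ∀ (x : Rn n) (r : ℝ), 0 < r →
      (∫⁻ y in ball x r, (∏ i, (‖f i y - ballAvg (f i) x r‖ₑ + bmoNorm (f i))) ^ p * u y) ^
        (1 / p) ≤ K * (∏ i, bmoNorm (f i)) * (∫⁻ y in ball x r, u y) ^ (1 / p) := by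
  have hm' : (0 : ℝ) < m := by exact_mod_cast hm
  have hpm : 0 < p * m := by positivity
  obtain ⟨K, hK⟩ := h.exists_rpow_lintegral_bmo_add_le (𝕜 := 𝕜) hn hpm
  refine ⟨(K * 2) ^ m, fun f hf x r hr => ?_⟩
  have hmeas : ∀ i, AEMeasurable
      (fun y => (‖f i y - ballAvg (f i) x r‖ₑ + bmoNorm (f i)) ^ (p * m) * u y)
      (volume.restrict (ball x r)) := fun i =>
    (((((hf i).1.aestronglyMeasurable.restrict.sub
      aestronglyMeasurable_const).enorm).add_const _).pow_const _).mul h.aemeas.restrict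
  have hH := ENNReal.lintegral_prod_norm_pow_le (μ := volume.restrict (ball x r)) Finset.univ
    (fun i _ => hmeas i) (p := fun _ => 1 / (m : ℝ)) (by simp [hm'.ne'])
    (fun i _ => by positivity)
  have e1 : ∀ y, ∏ i, ((‖f i y - ballAvg (f i) x r‖ₑ + bmoNorm (f i)) ^ (p * m) * u y) ^
      (1 / (m : ℝ)) = (∏ i, (‖f i y - ballAvg (f i) x r‖ₑ + bmoNorm (f i))) ^ p * u y := by
    intro y
    have h1 : (0 : ℝ) ≤ 1 / m := by positivity
    simp only [ENNReal.mul_rpow_of_nonneg _ _ h1, ← ENNReal.rpow_mul]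
    rw [Finset.prod_mul_distrib, Finset.prod_const, Finset.card_univ, Fintype.card_fin,
      ← ENNReal.rpow_natCast, ← ENNReal.rpow_mul, one_div_mul_cancel hm'.ne', ENNReal.rpow_one,
      show p * m * (1 / m) = p by field_simp, ENNReal.prod_rpow_of_nonneg hp.le]
  simp only [e1] at hH
  have h2 := ENNReal.rpow_le_rpow hH (one_div_pos.2 hp).le
  rw [← ENNReal.prod_rpow_of_nonneg (one_div_pos.2 hp).le] at h2
  simp only [← ENNReal.rpow_mul] at h2
  refine h2.trans ?_
  have e2 : 1 / (m : ℝ) * (1 / p) = 1 / (p * m) := by field_simp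
  rw [e2]
  calc _ ≤ ∏ i, (K * (bmoNorm (f i) + bmoNorm (f i)) *
        (∫⁻ y in ball x r, u y) ^ (1 / (p * m))) := by
        gcongr with i
        exact hK (f i) (hf i) x r hr _
    _ = ∏ i, ((K * 2) * bmoNorm (f i) * (∫⁻ y in ball x r, u y) ^ (1 / (p * m))) :=
        Finset.prod_congr rfl fun i _ => by ring
    _ = (K * 2) ^ m * (∏ i, bmoNorm (f i)) * (∫⁻ y in ball x r, u y) ^ (1 / p) := by
        rw [Finset.prod_mul_distrib, Finset.prod_mul_distrib, Finset.prod_const, Finset.prod_const,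
          Finset.card_univ, Fintype.card_fin]
        rw [← ENNReal.rpow_natCast (_ ^ (1 / (p * m))), ← ENNReal.rpow_mul,
          show 1 / (p * m) * m = 1 / p by field_simp]
    _ = _ := by push_cast; rfl

end IsDualPair

/-! ### The dyadic sum and the Hardy condition -/

theorem rpow_lintegral_le_morreyNorm_mul {p : ℝ} {φ : Rn n → ℝ → ℝ} {w : Rn n → ℝ} (f : Rn n → 𝕜)
    {x : Rn n} {r : ℝ} (hr : 0 < r) (hφ : 0 < φ x r) (hw0 : wt w (ball x r) ≠ 0)
    (hwtop : wt w (ball x r) ≠ ∞) :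
    (∫⁻ y in ball x r, ‖f y‖ₑ ^ p * ENNReal.ofReal (w y)) ^ (1 / p) ≤
      morreyNorm p φ w f * (ENNReal.ofReal (φ x r) * wt w (ball x r) ^ (1 / p)) := by
  set L := (∫⁻ y in ball x r, ‖f y‖ₑ ^ p * ENNReal.ofReal (w y)) ^ (1 / p) with hL
  have h1 := le_morreyNorm p φ w f x hr
  rw [← hL] at h1
  have h2 : ENNReal.ofReal (φ x r) * (ENNReal.ofReal (φ x r))⁻¹ = 1 :=
    ENNReal.mul_inv_cancel (ENNReal.ofReal_pos.2 hφ).ne' ENNReal.ofReal_ne_top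
  have h3 : wt w (ball x r) ^ (1 / p) * wt w (ball x r) ^ (-(1 / p)) = 1 := by
    rw [← ENNReal.rpow_add _ _ hw0 hwtop, add_neg_cancel, ENNReal.rpow_zero]
  calc L = (ENNReal.ofReal (φ x r) * (ENNReal.ofReal (φ x r))⁻¹) *
        (wt w (ball x r) ^ (1 / p) * wt w (ball x r) ^ (-(1 / p))) * L := by
        rw [h2, h3, one_mul, one_mul]
    _ = ((ENNReal.ofReal (φ x r))⁻¹ * wt w (ball x r) ^ (-(1 / p)) * L) *
        (ENNReal.ofReal (φ x r) * wt w (ball x r) ^ (1 / p)) := by ring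
    _ ≤ _ := by gcongr

/-- The sum over the dilates `2 ^ (j + 2) B` is at most a constant times the integral in
`hardyLogConst`: the `j`-th term is compared with the integral over the dyadic interval from
`2 ^ (j + 2) r` to `2 ^ (j + 3) r`, on which `1 + log (t / r)` is comparable with `j + 3`. -/
theorem exists_tsum_prod_le {pv : Fin m → ℝ} {ω : Fin m → Rn n → ℝ}
    {s : Fin m → Rn n → ℝ≥0∞} {b : Fin m → ℝ} {C : ℝ≥0}
    (hω : ∀ i, IsDualPair (fun y => ENNReal.ofReal (ω i y)) (s i) (1 / pv i) (b i) C)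
    {φ₁ : Fin m → Rn n → ℝ → ℝ} (hφ₁ : ∀ i, IsMorreyFun (φ₁ i)) {φ₂ : Rn n → ℝ → ℝ}
    (hφ₂ : IsMorreyFun φ₂) :
    ∃ K : ℝ≥0, ∀ f : Fin m → Rn n → 𝕜, (∀ i, f i ∈ morrey 𝕜 (pv i) (φ₁ i) (ω i)) →
      ∀ (x : Rn n) (r : ℝ), 0 < r →
      ∑' j : ℕ, ∏ i, (((j + 2 : ℕ) : ℝ≥0∞) + 1) *
        ((∫⁻ y in ball x (2 ^ (j + 2) * r), ‖f i y‖ₑ ^ pv i * ENNReal.ofReal (ω i y)) ^ (1 / pv i) /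
          wt (ω i) (ball x (2 ^ (j + 2) * r)) ^ (1 / pv i)) ≤
      K * (∏ i, morreyNorm (pv i) (φ₁ i) (ω i) (f i)) *
        (hardyLogConst pv ω φ₁ φ₂ * ENNReal.ofReal (φ₂ x r)) := by
  -- The doubling constant of `ω i` is `d i ^ pv i`.
  set d : Fin m → ℝ≥0∞ := fun i => C * ENNReal.ofReal (2 ^ n) with hd
  have hdtop : ∏ i, d i ≠ ∞ := by
    refine (ENNReal.prod_lt_top fun i _ => ?_).ne
    simp only [hd]
    finiteness
  have hKtop : 2 * (2 ^ m * ∏ i, d i) ≠ ∞ := by finiteness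
  refine ⟨(2 * (2 ^ m * ∏ i, d i)).toNNReal, fun f hf x r hr => ?_⟩
  rw [ENNReal.coe_toNNReal hKtop]
  set N := ∏ i, morreyNorm (pv i) (φ₁ i) (ω i) (f i) with hN
  have hNtop : N ≠ ∞ := (ENNReal.prod_lt_top fun i _ => (hf i).2).ne
  set E : ℝ → ℝ≥0∞ := fun t => essInf (fun η : ℝ => ∏ i, ENNReal.ofReal (φ₁ i x η) *
    wt (ω i) (ball x η) ^ (1 / pv i)) (volume.restrict (Ioi t)) with hE
  set W : Fin m → ℝ → ℝ≥0∞ := fun i t => wt (ω i) (ball x t) ^ (1 / pv i) with hW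
  set L : Fin m → ℝ → ℝ≥0∞ := fun i t =>
    (∫⁻ y in ball x t, ‖f i y‖ₑ ^ pv i * ENNReal.ofReal (ω i y)) ^ (1 / pv i) with hL
  have hwt0 : ∀ i t, 0 < t → wt (ω i) (ball x t) ≠ 0 := fun i t ht =>
    (hω i).lintegral_ne_zero x ht
  have hwttop : ∀ i t, 0 < t → wt (ω i) (ball x t) ≠ ∞ := fun i t ht =>
    (hω i).lintegral_ne_top x ht
  have hW0 : ∀ i t, 0 < t → W i t ≠ 0 := fun i t ht => by
    simp [hW, ENNReal.rpow_eq_zero_iff, hwt0 i t ht, hwttop i t ht]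
  have hWtop : ∀ i t, 0 < t → W i t ≠ ∞ := fun i t ht =>
    ENNReal.rpow_ne_top_of_nonneg (hω i).pos.le (hwttop i t ht)
  have hLE : ∀ t₀ t, 0 < t₀ → t₀ ≤ t → ∏ i, L i t₀ ≤ N * E t := by
    intro t₀ t ht₀ ht
    have h1 : ∀ η ∈ Ioi t, ∏ i, L i t₀ ≤ N * ∏ i, ENNReal.ofReal (φ₁ i x η) * W i η := by
      intro η hη
      have hη0 : 0 < η := ht₀.trans_le (ht.trans (le_of_lt hη))
      rw [hN, ← Finset.prod_mul_distrib]
      refine Finset.prod_le_prod' fun i _ => ?_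
      refine le_trans ?_ (rpow_lintegral_le_morreyNorm_mul (f i) hη0 ((hφ₁ i).1 x η hη0)
        (hwt0 i η hη0) (hwttop i η hη0))
      have := (hω i).pos.le
      refine ENNReal.rpow_le_rpow (lintegral_mono_set (ball_subset_ball ?_)) this
      exact ht.trans (le_of_lt hη)
    have h2 : (∏ i, L i t₀) / N ≤ E t := by
      refine le_essInf_of_ae_le _ ?_
      filter_upwards [ae_restrict_mem measurableSet_Ioi] with η hη
      exact ENNReal.div_le_of_le_mul' (h1 η hη)
    -- Passing from the quotient by `N` back to a product fails when `N = 0`; then the left side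
    -- vanishes.
    rcases eq_or_ne N 0 with h0 | h0
    · have := h1 (t + 1) (by simp)
      rw [h0, zero_mul] at this
      exact this.trans zero_le
    · calc ∏ i, L i t₀ = N * ((∏ i, L i t₀) / N) := (ENNReal.mul_div_cancel h0 hNtop).symm
        _ ≤ _ := by gcongr
  have hWd : ∀ i t₀ t, 0 < t₀ → 0 < t → t ≤ 2 * t₀ → W i t ≤ d i * W i t₀ := by
    intro i t₀ t ht₀ ht ht2
    have ha := (hω i).pos
    have h1 : wt (ω i) (ball x t) ≤ d i ^ (1 / (1 / pv i)) * wt (ω i) (ball x t₀) :=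
      (lintegral_mono_set (ball_subset_ball ht2)).trans
        ((hω i).lintegral_ball_mul_le one_le_two x ht₀)
    have h2 := ENNReal.rpow_le_rpow h1 ha.le
    rwa [ENNReal.mul_rpow_of_nonneg _ _ ha.le, ← ENNReal.rpow_mul, one_div_mul_cancel ha.ne',
      ENNReal.rpow_one] at h2
  set G : ℝ → ℝ≥0∞ := fun t => ENNReal.ofReal ((1 + Real.log (t / r)) ^ m) *
    (E t / ∏ i, W i t) * ENNReal.ofReal (1 / t) with hG
  set I : ℕ → Set ℝ := fun j => Ioc (2 ^ (j + 2) * r) (2 ^ (j + 3) * r) with hI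
  have hterm : ∀ j : ℕ, (∏ i, (((j + 2 : ℕ) : ℝ≥0∞) + 1) *
      (L i (2 ^ (j + 2) * r) / W i (2 ^ (j + 2) * r))) ≤
        2 * (2 ^ m * (∏ i, d i) * N) * ∫⁻ t in I j, G t := by
    intro j
    set t₀ : ℝ := 2 ^ (j + 2) * r with ht₀
    have ht₀0 : 0 < t₀ := by positivity
    have ht₁ : (2 : ℝ) ^ (j + 3) * r = 2 * t₀ := by rw [ht₀]; ring
    set A := ∏ i, (((j + 2 : ℕ) : ℝ≥0∞) + 1) * (L i t₀ / W i t₀) with hA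
    have hpt : ∀ t ∈ I j, A * ENNReal.ofReal (1 / (2 * t₀)) ≤ 2 ^ m * (∏ i, d i) * N * G t := by
      rintro t ⟨ht1, ht2⟩
      have ht2' : t ≤ 2 * t₀ := ht2.trans ht₁.le
      have ht0 : 0 < t := ht₀0.trans ht1
      -- This uses `1 ≤ 2 * log 2`.
      have hlog : ((j : ℝ) + 3) ≤ 2 * (1 + Real.log (t / r)) := by
        have h1 : Real.log (2 ^ (j + 2)) ≤ Real.log (t / r) := by
          refine Real.log_le_log (by positivity) ?_
          rw [le_div_iff₀ hr]; exact ht1.le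
        rw [Real.log_pow] at h1
        push_cast at h1
        have h2 := Real.log_two_gt_d9
        have h3 : 0 ≤ (j : ℝ) := by positivity
        nlinarith
      have hlog' : (((j + 2 : ℕ) : ℝ≥0∞) + 1) ^ m ≤
          2 ^ m * ENNReal.ofReal ((1 + Real.log (t / r)) ^ m) := by
        have h1 : (((j + 2 : ℕ) : ℝ≥0∞) + 1) = ENNReal.ofReal ((j : ℝ) + 3) := by
          rw [show ((j : ℝ) + 3) = ((j + 3 : ℕ) : ℝ) by push_cast; ring, ENNReal.ofReal_natCast]
          push_cast; ring
        have h4 : 0 ≤ 1 + Real.log (t / r) := by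
          have : (0 : ℝ) ≤ j := by positivity
          linarith
        rw [h1, ENNReal.ofReal_pow h4, ← mul_pow]
        gcongr
        rw [← ENNReal.ofReal_ofNat, ← ENNReal.ofReal_mul zero_le_two]
        exact ENNReal.ofReal_le_ofReal hlog
      have hLW : ∏ i, L i t₀ / W i t₀ ≤ (∏ i, d i) * N * (E t / ∏ i, W i t) := by
        have hP0 : ∏ i, W i t ≠ 0 := Finset.prod_ne_zero_iff.2 fun i _ => hW0 i t ht0
        have hPtop : ∏ i, W i t ≠ ∞ :=
          (ENNReal.prod_lt_top fun i _ => (hWtop i t ht0).lt_top).ne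
        rw [← mul_div_assoc, ENNReal.le_div_iff_mul_le (Or.inl hP0) (Or.inl hPtop),
          ← Finset.prod_mul_distrib]
        calc ∏ i, L i t₀ / W i t₀ * W i t ≤ ∏ i, d i * L i t₀ := by
              refine Finset.prod_le_prod' fun i _ => ?_
              calc L i t₀ / W i t₀ * W i t ≤ L i t₀ / W i t₀ * (d i * W i t₀) := by
                    gcongr; exact hWd i t₀ t ht₀0 ht0 ht2'
                _ = d i * (L i t₀ / W i t₀ * W i t₀) := by ring
                _ = d i * L i t₀ := by
                    rw [ENNReal.div_mul_cancel (hW0 i t₀ ht₀0) (hWtop i t₀ ht₀0)]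
          _ = (∏ i, d i) * ∏ i, L i t₀ := Finset.prod_mul_distrib
          _ ≤ (∏ i, d i) * (N * E t) := by gcongr; exact hLE t₀ t ht₀0 ht1.le
          _ = _ := by ring
      have hinv : ENNReal.ofReal (1 / (2 * t₀)) ≤ ENNReal.ofReal (1 / t) :=
        ENNReal.ofReal_le_ofReal (one_div_le_one_div_of_le ht0 ht2')
      calc A * ENNReal.ofReal (1 / (2 * t₀))
          = (((j + 2 : ℕ) : ℝ≥0∞) + 1) ^ m * (∏ i, L i t₀ / W i t₀) *
              ENNReal.ofReal (1 / (2 * t₀)) := by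
            rw [hA, Finset.prod_mul_distrib, Finset.prod_const, Finset.card_univ, Fintype.card_fin]
        _ ≤ (2 ^ m * ENNReal.ofReal ((1 + Real.log (t / r)) ^ m)) *
              ((∏ i, d i) * N * (E t / ∏ i, W i t)) * ENNReal.ofReal (1 / t) := by gcongr
        _ = _ := by simp only [hG]; ring
    have h1 : A * ENNReal.ofReal (1 / (2 * t₀)) * volume (I j) ≤
        2 ^ m * (∏ i, d i) * N * ∫⁻ t in I j, G t := by
      rw [← setLIntegral_const, ← lintegral_const_mul' _ _ (by finiteness)]
      exact setLIntegral_mono' measurableSet_Ioc hpt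
    have h2 : 2 * (ENNReal.ofReal (1 / (2 * t₀)) * volume (I j)) = 1 := by
      rw [hI, Real.volume_Ioc, ht₁, ← ENNReal.ofReal_mul (by positivity), ← ENNReal.ofReal_ofNat,
        ← ENNReal.ofReal_mul zero_le_two, ← ENNReal.ofReal_one]
      congr 1
      field_simp
      ring
    calc A = A * (2 * (ENNReal.ofReal (1 / (2 * t₀)) * volume (I j))) := by rw [h2, mul_one]
      _ = 2 * (A * ENNReal.ofReal (1 / (2 * t₀)) * volume (I j)) := by ring
      _ ≤ 2 * (2 ^ m * (∏ i, d i) * N * ∫⁻ t in I j, G t) := by gcongr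
      _ = _ := by ring
  have hdisj : Pairwise (Function.onFun Disjoint I) := by
    refine (pairwise_disjoint_on I).2 fun j k hjk => Set.disjoint_left.2 fun t ht ht' => ?_
    have h1 : (2 : ℝ) ^ (j + 3) ≤ 2 ^ (k + 2) := pow_le_pow_right₀ one_le_two (by omega)
    have h2 := ht.2
    have h3 := ht'.1
    nlinarith
  have hIsub : (⋃ j, I j) ⊆ Ioi r := by
    refine iUnion_subset fun j t ht => ?_
    have h1 : (1 : ℝ) ≤ 2 ^ (j + 2) := one_le_pow₀ one_le_two
    have h2 := ht.1
    simp only [mem_Ioi]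
    nlinarith
  have hint : ∫⁻ t in Ioi r, G t ≤ hardyLogConst pv ω φ₁ φ₂ * ENNReal.ofReal (φ₂ x r) := by
    have h1 : (ENNReal.ofReal (φ₂ x r))⁻¹ * ∫⁻ t in Ioi r, G t ≤ hardyLogConst pv ω φ₁ φ₂ :=
      le_iSup_of_le x (le_iSup_of_le r (le_iSup_of_le hr le_rfl))
    rwa [ENNReal.inv_mul_le_iff (ENNReal.ofReal_pos.2 (hφ₂.1 x r hr)).ne' ENNReal.ofReal_ne_top,
      mul_comm] at h1
  calc _ ≤ ∑' j, 2 * (2 ^ m * (∏ i, d i) * N) * ∫⁻ t in I j, G t := ENNReal.tsum_le_tsum hterm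
    _ = 2 * (2 ^ m * (∏ i, d i) * N) * ∫⁻ t in ⋃ j, I j, G t := by
        rw [ENNReal.tsum_mul_left, lintegral_iUnion (fun j => measurableSet_Ioc) hdisj]
    _ ≤ 2 * (2 ^ m * (∏ i, d i) * N) *
          (hardyLogConst pv ω φ₁ φ₂ * ENNReal.ofReal (φ₂ x r)) := by
        gcongr
        exact (lintegral_mono_set hIsub).trans hint
    _ = _ := by ring

/-! ### The bound for the commutator -/

/-- The bound in terms of the constants `A₁` and `A₂` of the size and boundedness conditions, with
`K` independent of `T`, `b`, `A₁` and `A₂`. -/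
theorem exists_morreyNorm_iterComm_le (hn : 1 ≤ n) (hm : 1 ≤ m)
    {pv : Fin m → ℝ} (hpv : ∀ i, 1 < pv i) {p : ℝ} (hp : 0 < p)
    {ω : Fin m → Rn n → ℝ} (hωP : MemAP pv p ω) (hω : ∀ i, MemAinfty (ω i))
    {v : Rn n → ℝ} (hv : MemAinfty v)
    {φ₁ : Fin m → Rn n → ℝ → ℝ} (hφ₁ : ∀ i, IsMorreyFun (φ₁ i))
    {φ₂ : Rn n → ℝ → ℝ} (hφ₂ : IsMorreyFun φ₂) (hφ : hardyLogConst pv ω φ₁ φ₂ < ∞) :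
    ∃ K : ℝ≥0, ∀ (T : (Fin m → Rn n → 𝕜) → Rn n → 𝕜) (b : Fin m → Rn n → 𝕜) (A₁ : ℝ≥0)
      (A₂ : ℝ≥0∞), (∀ i, MemBMO (b i)) →
      LSWith A₁ (fun i => commDomain (morrey 𝕜 (pv i) (φ₁ i) (ω i)) (b i)) T →
      LBWith A₂ (fun i => morrey 𝕜 (pv i) (φ₁ i) (ω i)) (fun i => morreyNorm (pv i) (φ₁ i) (ω i))
        (morreyNorm p φ₂ v) (iterComm b T) →
      ∀ f : Fin m → Rn n → 𝕜, (∀ i, f i ∈ morrey 𝕜 (pv i) (φ₁ i) (ω i)) →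
        morreyNorm p φ₂ v (iterComm b T f) ≤
          K * (A₂ + A₁ * ∏ i, bmoNorm (b i)) * ∏ i, morreyNorm (pv i) (φ₁ i) (ω i) (f i) := by
  classical
  have hpv0 : ∀ i, 0 < pv i := fun i => by linarith [hpv i]
  have hp' : 0 ≤ 1 / p := (one_div_pos.2 hp).le
  obtain ⟨C, hpair⟩ := hωP.isDualPair hpv hp hω
  obtain ⟨q, hq, hvq⟩ := hv.exists_memAq
  obtain ⟨C', hvpair⟩ := hvq.isDualPair hq
  choose κ hκ using fun i => (hpair i).exists_laverage_mul_le (𝕜 := 𝕜) hn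
  obtain ⟨K₁, hK₁⟩ := exists_tsum_prod_le (𝕜 := 𝕜) hpair hφ₁ hφ₂
  obtain ⟨K₂, hK₂⟩ := hvpair.exists_rpow_lintegral_prod_bmo_le (𝕜 := 𝕜) hn hm hp
  set H := hardyLogConst pv ω φ₁ φ₂ with hH
  set c₀ : ℝ≥0∞ := 2 * 2 ^ (1 / p) with hc₀
  have hc₀top : c₀ ≠ ∞ := by
    have : (2 : ℝ≥0∞) ^ (1 / p) ≠ ∞ := ENNReal.rpow_ne_top_of_nonneg hp' (by finiteness)
    finiteness
  set Q₀ : ℝ≥0∞ := 2 ^ m * (∏ i, (κ i : ℝ≥0∞)) * K₁ * H * K₂ with hQ₀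
  have hQ₀top : Q₀ ≠ ∞ := by
    have : ∏ i, (κ i : ℝ≥0∞) ≠ ∞ := (ENNReal.prod_lt_top fun i _ => ENNReal.coe_lt_top).ne
    finiteness
  have hKtop : c₀ * (1 + Q₀) ≠ ∞ := by finiteness
  refine ⟨(c₀ * (1 + Q₀)).toNNReal, fun T b A₁ A₂ hb hT hB f hf => ?_⟩
  rw [ENNReal.coe_toNNReal hKtop]
  set N := ∏ i, morreyNorm (pv i) (φ₁ i) (ω i) (f i) with hN
  set β := ∏ i, bmoNorm (b i) with hβ
  refine iSup_le fun x => iSup_le fun r => iSup_le fun hr => ?_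
  set F : Rn n → ℝ≥0∞ := fun y => ‖iterComm b T (splitAt ∅ x r f) y‖ₑ with hF
  set P : Rn n → ℝ≥0∞ :=
    fun y => ∏ i, (‖b i y - ballAvg (b i) x r‖ₑ + bmoNorm (b i)) with hP
  set Q : ℝ≥0∞ := 2 ^ m * (A₁ * ((∏ i, (κ i : ℝ≥0∞)) * (K₁ * N * (H * ENNReal.ofReal (φ₂ x r)))))
    with hQ
  have hlo : ∀ i, splitAt ∅ x r f i ∈ morrey 𝕜 (pv i) (φ₁ i) (ω i) := by
    intro i
    have : splitAt ∅ x r f i = (ball x (2 * r)).indicator (f i) := by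
      ext y; simp [splitAt]
    rw [this]
    exact indicator_mem_morrey (hpv0 i) (hf i) measurableSet_ball
  have hFm : AEMeasurable F (volume.restrict (ball x r)) := (hB.1.1 _ hlo).enorm.restrict
  have hsum : ∀ s : Finset (Fin m), ∑' j : ℕ, ∏ i, ⨍⁻ z in ball x (2 ^ (j + 2) * r),
      ‖(if i ∈ s then 1 else ballAvg (b i) x r - b i z) * f i z‖ₑ ∂volume ≤
        (∏ i, (κ i : ℝ≥0∞)) * (∏ i ∈ Finset.univ \ s, bmoNorm (b i)) *
          (K₁ * N * (H * ENNReal.ofReal (φ₂ x r))) := by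
    intro s
    have e1 : ∏ i, (if i ∈ s then 1 else bmoNorm (b i)) =
        ∏ i ∈ Finset.univ \ s, bmoNorm (b i) := by
      rw [← Finset.prod_sdiff (Finset.subset_univ s),
        Finset.prod_eq_one (s := s) fun i hi => by simp [hi], mul_one]
      exact Finset.prod_congr rfl fun i hi => by simp [(Finset.mem_sdiff.1 hi).2]
    calc _ ≤ ∑' j : ℕ, ∏ i, (κ i * (if i ∈ s then 1 else bmoNorm (b i)) *
          ((((j + 2 : ℕ) : ℝ≥0∞) + 1) *
            ((∫⁻ y in ball x (2 ^ (j + 2) * r), ‖f i y‖ₑ ^ pv i * ENNReal.ofReal (ω i y)) ^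
              (1 / pv i) / wt (ω i) (ball x (2 ^ (j + 2) * r)) ^ (1 / pv i)))) := by
          refine ENNReal.tsum_le_tsum fun j => Finset.prod_le_prod' fun i _ => ?_
          have h1 := hκ i (b i) (hb i) (f i) (hf i).1 x r hr (j + 2) (i ∈ s)
          rw [one_div_one_div] at h1
          exact h1
      _ = (∏ i, (κ i : ℝ≥0∞)) * (∏ i ∈ Finset.univ \ s, bmoNorm (b i)) *
          ∑' j : ℕ, ∏ i, ((((j + 2 : ℕ) : ℝ≥0∞) + 1) *
            ((∫⁻ y in ball x (2 ^ (j + 2) * r), ‖f i y‖ₑ ^ pv i * ENNReal.ofReal (ω i y)) ^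
              (1 / pv i) / wt (ω i) (ball x (2 ^ (j + 2) * r)) ^ (1 / pv i))) := by
          rw [← ENNReal.tsum_mul_left]
          refine tsum_congr fun j => ?_
          rw [Finset.prod_mul_distrib, Finset.prod_mul_distrib, e1]
      _ ≤ _ := by gcongr; exact hK₁ f hf x r hr
  have hpt : ∀ᵐ y ∂volume.restrict (ball x r), ‖iterComm b T f y‖ₑ ≤ F y + Q * P y := by
    have h1 := ae_enorm_iterComm_le
      (X := fun i => morreySubmodule 𝕜 (hpv0 i) (φ₁ i) (hωP.1 i))
      (fun i f hf A hA => indicator_mem_morrey (hpv0 i) hf hA) hT x hr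
      (fun i => ballAvg (b i) x r) hf
    filter_upwards [h1] with y hy
    refine hy.trans (add_le_add_right ?_ _)
    have e2 : P y = ∑ s : Finset (Fin m), (∏ i ∈ s, ‖b i y - ballAvg (b i) x r‖ₑ) *
        ∏ i ∈ Finset.univ \ s, bmoNorm (b i) := by
      simp only [hP]
      rw [Finset.prod_add, Finset.powerset_univ]
    rw [e2, hQ, mul_assoc]
    refine mul_le_mul_right ?_ _
    rw [Finset.mul_sum]
    refine Finset.sum_le_sum fun s _ => ?_
    calc _ ≤ (∏ i ∈ s, ‖b i y - ballAvg (b i) x r‖ₑ) * (A₁ * ((∏ i, (κ i : ℝ≥0∞)) *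
          (∏ i ∈ Finset.univ \ s, bmoNorm (b i)) *
          (K₁ * N * (H * ENNReal.ofReal (φ₂ x r))))) := by gcongr; exact hsum s
      _ = _ := by ring
  have hwt0 : wt v (ball x r) ≠ 0 := hvpair.lintegral_ne_zero x hr
  have hwttop : wt v (ball x r) ≠ ∞ := hvpair.lintegral_ne_top x hr
  have hvm : AEMeasurable (fun y => ENNReal.ofReal (v y)) (volume.restrict (ball x r)) :=
    hvpair.aemeas.restrict
  have hPm : AEMeasurable (fun y => P y ^ p * ENNReal.ofReal (v y))
      (volume.restrict (ball x r)) := by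
    refine ((Finset.aemeasurable_fun_prod _ fun i _ => ?_).pow_const p).mul hvm
    exact (((hb i).1.aestronglyMeasurable.restrict.sub
      aestronglyMeasurable_const).enorm).add_const _
  have hQP : (∫⁻ y in ball x r, (Q * P y) ^ p * ENNReal.ofReal (v y)) ^ (1 / p) ≤
      Q * (K₂ * β * wt v (ball x r) ^ (1 / p)) := by
    have h1 : ∫⁻ y in ball x r, (Q * P y) ^ p * ENNReal.ofReal (v y) =
        Q ^ p * ∫⁻ y in ball x r, P y ^ p * ENNReal.ofReal (v y) := by
      rw [← lintegral_const_mul'' _ hPm]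
      refine lintegral_congr fun y => ?_
      rw [ENNReal.mul_rpow_of_nonneg _ _ hp.le, mul_assoc]
    rw [h1, ENNReal.mul_rpow_of_nonneg _ _ hp', ← ENNReal.rpow_mul, mul_one_div_cancel hp.ne',
      ENNReal.rpow_one]
    gcongr
    exact hK₂ b hb x r hr
  have hmain : (∫⁻ y in ball x r, ‖iterComm b T f y‖ₑ ^ p * ENNReal.ofReal (v y)) ^ (1 / p) ≤
      c₀ * ((∫⁻ y in ball x r, F y ^ p * ENNReal.ofReal (v y)) ^ (1 / p) +
        Q * (K₂ * β * wt v (ball x r) ^ (1 / p))) := by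
    calc _ ≤ (∫⁻ y in ball x r, (F y + Q * P y) ^ p * ENNReal.ofReal (v y)) ^ (1 / p) := by
          refine ENNReal.rpow_le_rpow (lintegral_mono_ae ?_) hp'
          filter_upwards [hpt] with y hy
          have := hp.le
          gcongr
      _ ≤ _ := rpow_lintegral_add_rpow_mul_le hFm hvm hp
      _ ≤ _ := by gcongr
  have hfirst : (ENNReal.ofReal (φ₂ x r))⁻¹ * wt v (ball x r) ^ (-(1 / p)) *
      (∫⁻ y in ball x r, F y ^ p * ENNReal.ofReal (v y)) ^ (1 / p) ≤ A₂ * N :=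
    (le_morreyNorm p φ₂ v _ x hr).trans (hB.2 x r hr f hf)
  have h2 : (ENNReal.ofReal (φ₂ x r))⁻¹ * ENNReal.ofReal (φ₂ x r) = 1 :=
    ENNReal.inv_mul_cancel (ENNReal.ofReal_pos.2 (hφ₂.1 x r hr)).ne' ENNReal.ofReal_ne_top
  have h3 : wt v (ball x r) ^ (-(1 / p)) * wt v (ball x r) ^ (1 / p) = 1 := by
    rw [← ENNReal.rpow_add _ _ hwt0 hwttop, neg_add_cancel, ENNReal.rpow_zero]
  calc _ ≤ (ENNReal.ofReal (φ₂ x r))⁻¹ * wt v (ball x r) ^ (-(1 / p)) *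
        (c₀ * ((∫⁻ y in ball x r, F y ^ p * ENNReal.ofReal (v y)) ^ (1 / p) +
          Q * (K₂ * β * wt v (ball x r) ^ (1 / p)))) := by gcongr
    _ = c₀ * ((ENNReal.ofReal (φ₂ x r))⁻¹ * wt v (ball x r) ^ (-(1 / p)) *
          (∫⁻ y in ball x r, F y ^ p * ENNReal.ofReal (v y)) ^ (1 / p) +
        ((ENNReal.ofReal (φ₂ x r))⁻¹ * ENNReal.ofReal (φ₂ x r)) *
          (wt v (ball x r) ^ (-(1 / p)) * wt v (ball x r) ^ (1 / p)) *
          (Q₀ * (A₁ * β) * N)) := by rw [hQ, hQ₀]; ring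
    _ ≤ c₀ * (A₂ * N + 1 * 1 * (Q₀ * (A₁ * β) * N)) := by rw [h2, h3]; gcongr
    _ = c₀ * (A₂ + Q₀ * (A₁ * β)) * N := by ring
    _ ≤ c₀ * ((1 + Q₀) * (A₂ + A₁ * β)) * N := by
        gcongr
        calc A₂ + Q₀ * (A₁ * β) ≤ A₂ + Q₀ * (A₁ * β) + (Q₀ * A₂ + A₁ * β) := le_self_add
          _ = _ := by ring
    _ = _ := by ring

end MorreyComm

theorem theorem1p2 {𝕜 : Type*} [RCLike 𝕜] (n m : ℕ) (hn : 1 ≤ n) (hm : 1 ≤ m)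
    (pv : Fin m → ℝ) (hpv : ∀ i, 1 < pv i) (p : ℝ) (hp : 1 / p = ∑ i, 1 / pv i)
    (ω : Fin m → Rn n → ℝ) (hωP : MemAP pv p ω) (hω : ∀ i, MemAinfty (ω i))
    (v : Rn n → ℝ) (hv : MemAinfty v)
    (φ₁ : Fin m → Rn n → ℝ → ℝ) (hφ₁ : ∀ i, IsMorreyFun (φ₁ i))
    (φ₂ : Rn n → ℝ → ℝ) (hφ₂ : IsMorreyFun φ₂)
    (hφ : hardyLogConst pv ω φ₁ φ₂ < ∞) :
    -- boundedness of the iterated commutator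
    (∀ (T : (Fin m → Rn n → 𝕜) → Rn n → 𝕜) (b : Fin m → Rn n → 𝕜), (∀ i, MemBMO (b i)) →
      LS (fun i => commDomain (morrey 𝕜 (pv i) (φ₁ i) (ω i)) (b i)) T →
      LB (fun i => morrey 𝕜 (pv i) (φ₁ i) (ω i)) (fun i => morreyNorm (pv i) (φ₁ i) (ω i))
        (morreyNorm p φ₂ v) (iterComm b T) →
      ∃ C : ℝ≥0, ∀ f : Fin m → Rn n → 𝕜, (∀ i, f i ∈ morrey 𝕜 (pv i) (φ₁ i) (ω i)) →
        iterComm b T f ∈ morrey 𝕜 p φ₂ v ∧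
        morreyNorm p φ₂ v (iterComm b T f) ≤ C * ∏ i, morreyNorm (pv i) (φ₁ i) (ω i) (f i)) ∧
    -- the quantitative bound, with a constant independent of `b`, and of `T` except for
    -- the constants in its two hypotheses
    (∀ A₁ A₂ : ℝ≥0, ∃ C : ℝ≥0,
      ∀ (T : (Fin m → Rn n → 𝕜) → Rn n → 𝕜) (b : Fin m → Rn n → 𝕜), (∀ i, MemBMO (b i)) →
        LSWith A₁ (fun i => commDomain (morrey 𝕜 (pv i) (φ₁ i) (ω i)) (b i)) T →
        LBWith (A₂ * ∏ i, bmoNorm (b i)) (fun i => morrey 𝕜 (pv i) (φ₁ i) (ω i))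
          (fun i => morreyNorm (pv i) (φ₁ i) (ω i)) (morreyNorm p φ₂ v) (iterComm b T) →
        ∀ f : Fin m → Rn n → 𝕜, (∀ i, f i ∈ morrey 𝕜 (pv i) (φ₁ i) (ω i)) →
          morreyNorm p φ₂ v (iterComm b T f) ≤
            (C * ∏ i, bmoNorm (b i)) * ∏ i, morreyNorm (pv i) (φ₁ i) (ω i) (f i)) := by
  have hp0 : 0 < p := by
    rw [← one_div_pos, hp]
    exact Finset.sum_pos (fun i _ => one_div_pos.2 (by linarith [hpv i])) ⟨⟨0, hm⟩, by simp⟩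
  obtain ⟨K, hK⟩ := exists_morreyNorm_iterComm_le (𝕜 := 𝕜) hn hm hpv hp0 hωP hω hv hφ₁ hφ₂ hφ
  refine ⟨fun T b hb hT hB => ?_, fun A₁ A₂ => ⟨K * (A₂ + A₁), fun T b hb hT hB f hf => ?_⟩⟩
  · obtain ⟨A₁, hT⟩ := hT
    obtain ⟨A₂, hB⟩ := hB
    have hb' : ∏ i, bmoNorm (b i) ≠ ∞ := (ENNReal.prod_lt_top fun i _ => (hb i).2).ne
    have htop : (K : ℝ≥0∞) * (A₂ + A₁ * ∏ i, bmoNorm (b i)) ≠ ∞ := by finiteness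
    refine ⟨((K : ℝ≥0∞) * (A₂ + A₁ * ∏ i, bmoNorm (b i))).toNNReal, fun f hf => ?_⟩
    rw [ENNReal.coe_toNNReal htop]
    have h1 := hK T b A₁ A₂ hb hT hB f hf
    refine ⟨⟨hB.1.1 f hf, h1.trans_lt ?_⟩, h1⟩
    exact ENNReal.mul_lt_top htop.lt_top (ENNReal.prod_lt_top fun i _ => (hf i).2)
  · refine (hK T b A₁ _ hb hT hB f hf).trans (le_of_eq ?_)
    push_cast
    ring
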